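/- \textbf{Setting.} Let $K\subset\mathbb R^2$ be an oriented virtual link diagram, i.e. an immersion of a disjoint union of $n$ oriented circles whose double points are classical or virtual crossings, in Morse position (the second coordinate is a Morse function on $K$); the circles are numbered $1,\dots,n$. Two such diagrams determine the same welded virtual link if they are related by planar isotopy, the classical Reidemeister moves I, II, III, the virtual and mixed Reidemeister moves, and the first forbidden move $F_1$ (a strand passes over a virtual crossing), for all orientations. An \emph{edge} of $K$ is a connected component of $K$ minus its crossings and extreme points. Let $\kappa_n=\mathbb Z[X_1^{\pm1},\dots,X_n^{\pm1}]$, and for an edge let its variable be $X_i$ if it lies on the $i$-th circle. \textbf{The module.} $\mathrm{CM}(K)$ is the $\kappa_n$-module generated by the edges of $K$ with the following relations. At an extreme point the two incident edges are $e$ and $-e$. At a crossing let $e,f$ be the bottom left and bottom right edges, with variables $X,Y$, and $p,q$ the top left and top right edges. If the crossing is virtual, $p=f$ and $q=e$. If the strand from bottom left to top right is over, $p=Zf$ and $q=e+f-Zf$, where $Z=X^{-1}$ if that strand is oriented upwards and $Z=X$ otherwise. If the strand from bottom right to top left is over, $p=f+e-Ze$ and $q=Ze$, where $Z=Y$ if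 that strand is oriented upwards and $Z=Y^{-1}$ otherwise. \textbf{Colourings.} A crossed module consists of a group morphism $\partial\colon E\to G$ and a left action $\triangleright$ of $G$ on $E$ by automorphisms with $\partial(X\triangleright e)=X\partial(e)X^{-1}$ and $\partial(e)\triangleright f=efe^{-1}$; a morphism is a pair of group morphisms that commutes with $\partial$ and with the actions. It is automorphic if $\partial$ is trivial; then $E$ is abelian. For $\mathcal G=(E,G,\triangleright)$ automorphic and finite, $\mathcal H_{\mathcal G}(K)$ is the number of reduced $\mathcal G$-colourings, i.e. assignments of a pair in $G\times E$ to each edge such that the edges at an extreme point have colours $(X,e)$ and $(X,e^{-1})$, and at a crossing with bottom colours $(X,e)$, $(Y,f)$ the top left and top right colours are: $(Y,f)$, $(X,e)$ if it is virtual; $(ZYZ^{-1},Z\triangleright f)$, $(X,\,e f\,Z\triangleright f^{-1})$ if the strand from the bottom left is over; $(Y,\,f e\,Z\triangleright e^{-1})$, $(ZXZ^{-1},Z\triangleright e)$ if the strand from the bottom right is over, with $Z=X^{\pm1}$, resp. $Z=Y^{\pm1}$, as above. \textbf{Theorem.} (a) If $K$ and $K'$ determine the same welded virtual link, then $K'$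 also has $n$ circles, and for any numbering of the circles of $K$ there is a numbering of the circles of $K'$ such that $\mathrm{CM}(K)\cong\mathrm{CM}(K')$ as $\kappa_n$-modules. That is, up to reordering of the components, the isomorphism class of $\mathrm{CM}(K)$ depends only on the welded virtual link determined by $K$. (b) For every finite automorphic crossed module $\mathcal G=(E,G,\triangleright)$ with $G$ abelian, $$\mathcal H_{\mathcal G}(K)=\#\,\mathrm{Hom}(\mathrm{CM}(K),\mathcal G),$$ the number of crossed module morphisms $\mathrm{CM}(K)\to\mathcal G$, where $\mathrm{CM}(K)$ is regarded as the automorphic crossed module given by its additive group and the free abelian group on $X_1,\dots,X_n$ acting on it by multiplication. -/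

import Mathlib

/-!
# Welded virtual links, reduced colourings by crossed modules, and the module `CM(K)`

An oriented virtual link diagram in the plane on which the height is a Morse function is
described by the list of its critical events (minima, maxima, crossings) read from bottom to top;
each event is given with the number of strands passing on its left.
-/

namespace Welded

/-- The three kinds of crossing of two strands, one running from bottom left to top right, the
other from bottom right to top left: the first strand is over, the second is over, or the
crossing is virtual. -/
inductive Crossing : Type
  | overLeft
  | overRight
  | virt

/-- The crossing that undoes a given one when placed on top of it. -/
def Crossing.inv : Crossing → Crossing
  | .overLeft => .overRight
  | .overRight => .overLeft
  | .virt => .virt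

/-- Critical events. A minimum `cup d` creates two neighbouring strands; the left one is oriented
upwards if `d = true` and downwards if `d = false`, and the right one is oriented oppositely.
A maximum `cap` joins two neighbouring strands of opposite orientations. -/
inductive Event : Type
  | cup (d : Bool)
  | cap
  | cross (k : Crossing)

/-- Number of strands entering an event from below. -/
def Event.ins : Event → ℕ
  | .cup _ => 0
  | .cap => 2
  | .cross _ => 2

/-- Number of strands leaving an event upwards. -/
def Event.outs : Event → ℕ
  | .cup _ => 2
  | .cap => 0
  | .cross _ => 2

/-- An event together with the number `pos` of strands passing on its left. -/
structure Slice : Type where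
  pos : ℕ
  event : Event

/-- Names for the connected components of a diagram minus its crossings and extreme points.
Each of them is an open interval on which the height is monotone, so it has a unique lower end,
at a minimum or at a crossing: `(t, false)` and `(t, true)` are the left and the right one starting
upwards from the `t`-th event. -/
abbrev EdgeName : Type := ℕ × Bool

/-- A strand met by a horizontal line: the edge it belongs to, and whether it is oriented upwards
there. -/
structure Strand : Type where
  edge : EdgeName
  up : Bool

/-- The vertices of a diagram, with the incident edges. For a crossing: its kind, whether the
strand starting at the bottom left and the one starting at the bottom right are oriented
upwards, and the edges at the bottom left, bottom right, top left and top right. -/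
inductive Vertex : Type
  | min (l r : EdgeName)
  | max (l r : EdgeName)
  | cross (k : Crossing) (upL upR : Bool) (bl br tl tr : EdgeName)

/-- Edges starting upwards from a vertex. -/
def Vertex.tops : Vertex → List EdgeName
  | .min l r => [l, r]
  | .max _ _ => []
  | .cross _ _ _ _ _ tl tr => [tl, tr]

/-- `read t σ w` reads the events `w` from bottom to top, starting at time `t` on a line that
meets the strands `σ` from left to right. It returns the list of vertices met, or `none` if the
events do not fit the strands (wrong number of strands, or a maximum joining two strands whose
orientations do not match) or if some strand is left over at the top. -/
def read : ℕ → List Strand → List Slice → Option (List Vertex)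
  | _, [], [] => some []
  | _, _ :: _, [] => none
  | t, σ, ⟨i, .cup d⟩ :: w =>
    if i ≤ σ.length then
      (read (t + 1) (σ.take i ++ ⟨(t, false), d⟩ :: ⟨(t, true), !d⟩ :: σ.drop i) w).map
        (Vertex.min (t, false) (t, true) :: ·)
    else none
  | t, σ, ⟨i, .cap⟩ :: w =>
    match σ.drop i with
    | a :: b :: ρ =>
      if a.up = !b.up then
        (read (t + 1) (σ.take i ++ ρ) w).map (Vertex.max a.edge b.edge :: ·)
      else none
    | _ => none
  | t, σ, ⟨i, .cross k⟩ :: w =>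
    match σ.drop i with
    | a :: b :: ρ =>
      (read (t + 1) (σ.take i ++ ⟨(t, false), b.up⟩ :: ⟨(t, true), a.up⟩ :: ρ) w).map
        (Vertex.cross k a.up b.up a.edge b.edge (t, false) (t, true) :: ·)
    | _ => none

/-- Oriented virtual link diagrams in Morse position: lists of events that form a closed oriented
diagram. -/
structure Diagram : Type where
  word : List Slice
  closed : (read 0 [] word).isSome

namespace Diagram

/-- The crossings and extreme points of a diagram. -/
def vertices (K : Diagram) : List Vertex := (read 0 [] K.word).get K.closed

/-- The connected components of the diagram minus its crossings and extreme points. -/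
def Edge (K : Diagram) : Type := {e : EdgeName // ∃ v ∈ K.vertices, e ∈ v.tops}

/-- Two edges follow each other on a circle of the diagram, through an extreme point or straight
through a crossing. -/
inductive Joined (K : Diagram) : K.Edge → K.Edge → Prop
  | min {l r : K.Edge} (h : Vertex.min l.1 r.1 ∈ K.vertices) : Joined K l r
  | max {l r : K.Edge} (h : Vertex.max l.1 r.1 ∈ K.vertices) : Joined K l r
  | risingRight {k : Crossing} {u v : Bool} {bl br tl tr : K.Edge}
      (h : Vertex.cross k u v bl.1 br.1 tl.1 tr.1 ∈ K.vertices) : Joined K bl tr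
  | risingLeft {k : Crossing} {u v : Bool} {bl br tl tr : K.Edge}
      (h : Vertex.cross k u v bl.1 br.1 tl.1 tr.1 ∈ K.vertices) : Joined K br tl

/-- The circles of which the diagram is an immersion: edges up to the equivalence relation
generated by `Joined`. -/
def Component (K : Diagram) : Type := Quot K.Joined

/-- The circle that contains an edge. -/
def comp (K : Diagram) (e : K.Edge) : K.Component := Quot.mk _ e

end Diagram

/-! ### Welded equivalence -/

/-- Triangle moves allowed on three strands numbered `1, 2, 3` from left to right at the bottom,
where `a`, `b`, `c` are the crossings of the pairs `(1, 2)`, `(1, 3)`, `(2, 3)`. -/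
inductive Triangle : Crossing → Crossing → Crossing → Prop
  /-- Reidemeister III: all crossings classical, and the relation "over" is not cyclic. -/
  | reidemeister {a b c : Crossing} (ha : a ≠ .virt) (hb : b ≠ .virt) (hc : c ≠ .virt)
      (h : a = c → b = a) : Triangle a b c
  /-- Strand `3` crosses the other two virtually (this includes the purely virtual move). -/
  | virtual₃ (a : Crossing) : Triangle a .virt .virt
  /-- Strand `2` crosses the other two virtually. -/
  | virtual₂ (b : Crossing) : Triangle .virt b .virt
  /-- Strand `1` crosses the other two virtually. -/
  | virtual₁ (c : Crossing) : Triangle .virt .virt c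
  /-- First forbidden move: strand `1` passes over the virtual crossing of the other two. -/
  | over₁ : Triangle .overLeft .overLeft .virt
  /-- First forbidden move: strand `2` passes over the virtual crossing of the other two. -/
  | over₂ : Triangle .overRight .virt .overLeft
  /-- First forbidden move: strand `3` passes over the virtual crossing of the other two. -/
  | over₃ : Triangle .virt .overRight .overRight

/-- Local moves, for every orientation of the strands. -/
inductive Move : List Slice → List Slice → Prop
  /-- Planar isotopy: an event `b` lying to the right of an event `a`, with `m` strands between
  them, may be moved below `a`. -/
  | exchange (i m : ℕ) (a b : Event) :
      Move [⟨i, a⟩, ⟨i + a.outs + m, b⟩] [⟨i + a.ins + m, b⟩, ⟨i, a⟩]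
  /-- Planar isotopy: a maximum cancels against a minimum. -/
  | zigzagRight (i : ℕ) (d : Bool) : Move [⟨i + 1, .cup d⟩, ⟨i, .cap⟩] []
  | zigzagLeft (i : ℕ) (d : Bool) : Move [⟨i, .cup d⟩, ⟨i + 1, .cap⟩] []
  /-- Planar isotopy: a strand crossing one branch at an extreme point is moved to cross the
  other branch. -/
  | slideCup (i : ℕ) (d : Bool) (k : Crossing) :
      Move [⟨i, .cup d⟩, ⟨i + 1, .cross k⟩] [⟨i + 1, .cup d⟩, ⟨i, .cross k.inv⟩]
  | slideCap (i : ℕ) (k : Crossing) :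
      Move [⟨i + 1, .cross k⟩, ⟨i, .cap⟩] [⟨i, .cross k.inv⟩, ⟨i + 1, .cap⟩]
  /-- Classical and virtual Reidemeister I. -/
  | curlRight (i : ℕ) (d : Bool) (k : Crossing) :
      Move [⟨i + 1, .cup d⟩, ⟨i, .cross k⟩, ⟨i + 1, .cap⟩] []
  | curlLeft (i : ℕ) (d : Bool) (k : Crossing) :
      Move [⟨i, .cup d⟩, ⟨i + 1, .cross k⟩, ⟨i, .cap⟩] []
  /-- Classical and virtual Reidemeister II. -/
  | bigon (i : ℕ) (k : Crossing) : Move [⟨i, .cross k⟩, ⟨i, .cross k.inv⟩] []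
  /-- Classical, virtual and mixed Reidemeister III, and the first forbidden move. -/
  | triangle (i : ℕ) {a b c : Crossing} (h : Triangle a b c) :
      Move [⟨i, .cross a⟩, ⟨i + 1, .cross b⟩, ⟨i, .cross c⟩]
        [⟨i + 1, .cross c⟩, ⟨i, .cross b⟩, ⟨i + 1, .cross a⟩]

/-- Two diagrams differ by one local move. -/
def Diagram.Step (K K' : Diagram) : Prop :=
  ∃ p q A B : List Slice, Move A B ∧ K.word = p ++ A ++ q ∧ K'.word = p ++ B ++ q

/-- Two diagrams determine the same welded virtual link. -/
def Diagram.WeldedEquiv : Diagram → Diagram → Prop := Relation.EqvGen Diagram.Step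

/-! ### Crossed modules -/

/-- A crossed module `∂ : E → G` with a left action `act` of `G` on `E` by automorphisms. -/
structure CrossedModule (E G : Type*) [Group E] [Group G] where
  bd : E →* G
  act : G →* MulAut E
  bd_act : ∀ (X : G) (e : E), bd (act X e) = X * bd e * X⁻¹
  act_bd : ∀ e f : E, act (bd e) f = e * f * e⁻¹

namespace CrossedModule

variable {E G E' G' : Type*} [Group E] [Group G] [Group E'] [Group G']

/-- A crossed module is automorphic if its boundary map is trivial. -/
def IsAutomorphic (𝒢 : CrossedModule E G) : Prop := ∀ e : E, 𝒢.bd e = 1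

/-- Morphisms of crossed modules. -/
structure Hom (𝒢 : CrossedModule E G) (ℋ : CrossedModule E' G') where
  top : E →* E'
  base : G →* G'
  bd_top : ∀ e : E, ℋ.bd (top e) = base (𝒢.bd e)
  top_act : ∀ (X : G) (e : E), top (𝒢.act X e) = ℋ.act (base X) (top e)

end CrossedModule

/-! ### Reduced colourings -/

/-- `1` for a strand oriented upwards and `-1` for a strand oriented downwards. -/
def sgn (up : Bool) : ℤ := if up then 1 else -1

section Colourings

variable {E G : Type*} [Group E] [Group G]

/-- Reduced `𝒢`-colourings: a pair in `G × E` for each connected component of the diagram minus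
its crossings and extreme points. -/
structure IsReducedColouring (𝒢 : CrossedModule E G) (K : Diagram) (c : K.Edge → G × E) :
    Prop where
  min : ∀ l r : K.Edge, Vertex.min l.1 r.1 ∈ K.vertices →
    (c r).1 = (c l).1 ∧ (c r).2 = (c l).2⁻¹
  max : ∀ l r : K.Edge, Vertex.max l.1 r.1 ∈ K.vertices →
    (c r).1 = (c l).1 ∧ (c r).2 = (c l).2⁻¹
  /-- `(X, e)` and `(Y, f)` at the bottom, the strand coloured by `X` being over; `Z` is `X⁻¹` if
  that strand is oriented upwards, and `X` otherwise. -/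
  overLeft : ∀ (u v : Bool) (bl br tl tr : K.Edge),
    Vertex.cross .overLeft u v bl.1 br.1 tl.1 tr.1 ∈ K.vertices →
    ∀ (X Y Z : G) (e f : E), c bl = (X, e) → c br = (Y, f) → Z = X ^ (-sgn u) →
      c tl = (Z * Y * Z⁻¹, 𝒢.act Z f) ∧ c tr = (X, e * f * 𝒢.act Z f⁻¹)
  /-- `(X, e)` and `(Y, f)` at the bottom, the strand coloured by `Y` being over; `Z` is `Y` if
  that strand is oriented upwards, and `Y⁻¹` otherwise. -/
  overRight : ∀ (u v : Bool) (bl br tl tr : K.Edge),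
    Vertex.cross .overRight u v bl.1 br.1 tl.1 tr.1 ∈ K.vertices →
    ∀ (X Y Z : G) (e f : E), c bl = (X, e) → c br = (Y, f) → Z = Y ^ sgn v →
      c tl = (Y, f * e * 𝒢.act Z e⁻¹) ∧ c tr = (Z * X * Z⁻¹, 𝒢.act Z e)
  virt : ∀ (u v : Bool) (bl br tl tr : K.Edge),
    Vertex.cross .virt u v bl.1 br.1 tl.1 tr.1 ∈ K.vertices → c tl = c br ∧ c tr = c bl

/-- The number of reduced `𝒢`-colourings of a diagram. -/
noncomputable def colouringNumber (𝒢 : CrossedModule E G) (K : Diagram) : ℕ :=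
  Nat.card {c : K.Edge → G × E // IsReducedColouring 𝒢 K c}

end Colourings

/-! ### The module `CM(K)` -/

/-- The ring `κ n` of Laurent polynomials over `ℤ` in `n` variables, as the group ring of the free
abelian group on the variables. -/
abbrev LaurentRing (n : ℕ) : Type := AddMonoidAlgebra ℤ (Fin n →₀ ℤ)

/-- The power `X_i ^ ε` in `κ n`. -/
noncomputable def LaurentRing.X {n : ℕ} (i : Fin n) (ε : ℤ) : LaurentRing n :=
  AddMonoidAlgebra.single (Finsupp.single i ε) 1

/-- The generator of the free `κ n`-module on the edges given by an edge. -/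
noncomputable def gen {K : Diagram} (n : ℕ) (e : K.Edge) : K.Edge →₀ LaurentRing n :=
  Finsupp.single e 1

/-- Defining relators of `CM(K)`, for a numbering `ℓ` of the circles. The variable acting at a
crossing is the one of the circle containing the over strand. -/
inductive Relator (K : Diagram) {n : ℕ} (ℓ : K.Component ≃ Fin n) :
    (K.Edge →₀ LaurentRing n) → Prop
  | min {l r : K.Edge} (h : Vertex.min l.1 r.1 ∈ K.vertices) :
      Relator K ℓ (gen n r - -gen n l)
  | max {l r : K.Edge} (h : Vertex.max l.1 r.1 ∈ K.vertices) :
      Relator K ℓ (gen n r - -gen n l)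
  | overLeft_under {u v : Bool} {bl br tl tr : K.Edge}
      (h : Vertex.cross .overLeft u v bl.1 br.1 tl.1 tr.1 ∈ K.vertices) :
      Relator K ℓ (gen n tl - LaurentRing.X (ℓ (K.comp bl)) (-sgn u) • gen n br)
  | overLeft_over {u v : Bool} {bl br tl tr : K.Edge}
      (h : Vertex.cross .overLeft u v bl.1 br.1 tl.1 tr.1 ∈ K.vertices) :
      Relator K ℓ (gen n tr -
        (gen n bl + gen n br - LaurentRing.X (ℓ (K.comp bl)) (-sgn u) • gen n br))
  | overRight_under {u v : Bool} {bl br tl tr : K.Edge}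
      (h : Vertex.cross .overRight u v bl.1 br.1 tl.1 tr.1 ∈ K.vertices) :
      Relator K ℓ (gen n tr - LaurentRing.X (ℓ (K.comp br)) (sgn v) • gen n bl)
  | overRight_over {u v : Bool} {bl br tl tr : K.Edge}
      (h : Vertex.cross .overRight u v bl.1 br.1 tl.1 tr.1 ∈ K.vertices) :
      Relator K ℓ (gen n tl -
        (gen n br + gen n bl - LaurentRing.X (ℓ (K.comp br)) (sgn v) • gen n bl))
  | virt_left {u v : Bool} {bl br tl tr : K.Edge}
      (h : Vertex.cross .virt u v bl.1 br.1 tl.1 tr.1 ∈ K.vertices) :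
      Relator K ℓ (gen n tl - gen n br)
  | virt_right {u v : Bool} {bl br tl tr : K.Edge}
      (h : Vertex.cross .virt u v bl.1 br.1 tl.1 tr.1 ∈ K.vertices) :
      Relator K ℓ (gen n tr - gen n bl)

/-- The `κ n`-module `CM(K)` of a diagram `K` whose circles are numbered by `ℓ`. -/
abbrev CM (K : Diagram) {n : ℕ} (ℓ : K.Component ≃ Fin n) : Type :=
  (K.Edge →₀ LaurentRing n) ⧸ Submodule.span (LaurentRing n) {x | Relator K ℓ x}

/-- A `κ n`-module `M` as an automorphic crossed module: the free abelian group on `X_1, …, X_n`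
acts on the additive group of `M` by multiplication with monomials. -/
noncomputable def moduleCrossedModule (n : ℕ) (M : Type*) [AddCommGroup M]
    [Module (LaurentRing n) M] :
    CrossedModule (Multiplicative M) (Multiplicative (Fin n →₀ ℤ)) where
  bd := 1
  act :=
    { toFun := fun g =>
        { toFun := fun m =>
            Multiplicative.ofAdd
              (AddMonoidAlgebra.of ℤ (Fin n →₀ ℤ) g • Multiplicative.toAdd m)
          invFun := fun m =>
            Multiplicative.ofAdd
              (AddMonoidAlgebra.of ℤ (Fin n →₀ ℤ) g⁻¹ • Multiplicative.toAdd m)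
          left_inv := fun m => by
            simp only [toAdd_ofAdd, smul_smul, ← map_mul, inv_mul_cancel, map_one, one_smul,
              ofAdd_toAdd]
          right_inv := fun m => by
            simp only [toAdd_ofAdd, smul_smul, ← map_mul, mul_inv_cancel, map_one, one_smul,
              ofAdd_toAdd]
          map_mul' := fun a b => by
            simp only [toAdd_mul, smul_add, ofAdd_add] }
      map_one' := by
        ext m
        simp only [MulEquiv.coe_mk, Equiv.coe_fn_mk, map_one, one_smul, ofAdd_toAdd,
          MulAut.one_apply]
      map_mul' := fun g h => by
        ext m
        simp only [MulEquiv.coe_mk, Equiv.coe_fn_mk, map_mul, mul_smul, toAdd_ofAdd,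
          MulAut.mul_apply] }
  bd_act := fun X e => by simp
  act_bd := fun e f => by
    simp only [MonoidHom.one_apply, map_one, MulAut.one_apply, mul_comm e f, mul_inv_cancel_right]

end Welded

/-! Given labels `S`, a module `M` and units `z : S → Rˣ`, colour each edge by a label and a value.
Labels run unchanged along the circles. Values obey the relations of `CM(K)`, with `z` of the over
strand's label in place of the variable. Read from bottom to top, such a colouring is a `Run`: every
event relates the coloured strands below it to those above it. The two sides of a local move relate
the same bottom lines to the same top lines (for strands that fit the move), and two such lines
determine all strands inside the move. So a move gives a bijection between the colourings of two
closed diagrams which is natural in labels and values; this is a `Transfer`.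

Part (a) is then a Yoneda argument. With trivial values, colourings are maps from the circles to
`S`, and naturality matches the circles of the two diagrams (`Transfer.exists_component_equiv`).
`CM(K)` carries the universal colouring with values in a module (`CM.respects`, `CM.exists_lift`).
Transporting the universal colouring of each diagram to the other gives linear maps in both
directions, and uniqueness of the transported colouring makes them inverse to each other.

One asymmetry needs care: some moves have an empty side, which accepts every line, while their other
side restricts the number and the orientations of the strands. The missing information comes from
the colour-free run of the closed diagram (`Fits`).

For part (b), `G` is abelian, so the conjugations in the crossing rules disappear and the `G`-colour
is constant on circles: it is a morphism from the free abelian group to `G`. It turns `E` into a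
module over the Laurent polynomials, and the `E`-colours then satisfy precisely the relations of
`CM(K)`, so they amount to a linear map from `CM(K)` to `E`. -/

namespace Welded

/-! ### Coloured strands and the algebra of a single crossing -/

/-- A strand crossing a horizontal line, with its orientation, the label of its circle and the
value of its edge. -/
@[ext] structure Tint (S M : Type*) : Type _ where
  up : Bool
  label : S
  val : M

namespace Tint

variable {R S M S' M' : Type*} [CommRing R] [AddCommGroup M] [Module R M]
  [AddCommGroup M'] [Module R M']

/-- The other branch at an extreme point. -/
@[simps] def bar (a : Tint S M) : Tint S M := ⟨!a.up, a.label, -a.val⟩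

@[simp] theorem bar_bar (a : Tint S M) : a.bar.bar = a := by
  ext <;> simp

theorem bar_injective : Function.Injective (bar : Tint S M → Tint S M) :=
  Function.LeftInverse.injective bar_bar

/-- The top left strand of a crossing with given bottom strands. -/
def topLeft (z : S → Rˣ) : Crossing → Tint S M → Tint S M → Tint S M
  | .overLeft, a, b => ⟨b.up, b.label, z a.label ^ (-sgn a.up) • b.val⟩
  | .overRight, a, b => ⟨b.up, b.label, b.val + a.val - z b.label ^ sgn b.up • a.val⟩
  | .virt, _, b => b

/-- The top right strand of a crossing with given bottom strands. -/
def topRight (z : S → Rˣ) : Crossing → Tint S M → Tint S M → Tint S M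
  | .overLeft, a, b => ⟨a.up, a.label, a.val + b.val - z a.label ^ (-sgn a.up) • b.val⟩
  | .overRight, a, b => ⟨a.up, a.label, z b.label ^ sgn b.up • a.val⟩
  | .virt, a, _ => a

variable (z : S → Rˣ) (k : Crossing) (a b c : Tint S M)

@[simp] theorem up_topLeft : (topLeft z k a b).up = b.up := by cases k <;> rfl

@[simp] theorem up_topRight : (topRight z k a b).up = a.up := by cases k <;> rfl

@[simp] theorem label_topLeft : (topLeft z k a b).label = b.label := by cases k <;> rfl

@[simp] theorem label_topRight : (topRight z k a b).label = a.label := by cases k <;> rfl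

@[simp] theorem sgn_not (u : Bool) : sgn (!u) = -sgn u := by cases u <;> rfl

theorem _root_.Welded.Crossing.inv_inv (k : Crossing) : k.inv.inv = k := by cases k <;> rfl

/-- The over strand keeps its orientation but is met once from the left and once from the right, so
the two powers of its unit are inverse, and the difference `f - Z f` it absorbs is given back. -/
theorem topLeft_bigon : topLeft z k.inv (topLeft z k a b) (topRight z k a b) = a := by
  cases k <;> ext <;> simp [topLeft, topRight, Crossing.inv]

theorem topRight_bigon : topRight z k.inv (topLeft z k a b) (topRight z k a b) = b := by
  cases k <;> ext <;> simp [topLeft, topRight, Crossing.inv]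

/-- The same crossing is read sideways. If the branch of the minimum is over, reversing it by `bar`
compensates the change of exponent between `k` and `k.inv`. If it is under, it is traversed the
other way and meets the inverse unit. -/
theorem topLeft_slideCup :
    topLeft z k.inv b (topRight z k a.bar b).bar = a := by
  cases k <;> ext <;> simp [topLeft, topRight, Crossing.inv]
  abel

theorem topRight_slideCup :
    topRight z k.inv b (topRight z k a.bar b).bar = topLeft z k a.bar b := by
  cases k <;> ext <;> simp [topLeft, topRight, Crossing.inv]; all_goals abel

theorem topLeft_slideCup' :
    topLeft z k (topLeft z k.inv b a).bar b = topRight z k.inv b a := by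
  cases k <;> ext <;> simp [topLeft, topRight, Crossing.inv]; all_goals abel

theorem topRight_slideCup' :
    topRight z k (topLeft z k.inv b a).bar b = a.bar := by
  cases k <;> ext <;> simp [topLeft, topRight, Crossing.inv]
  abel

/-- A maximum is a minimum upside down: the identities for minima, applied to `k.inv`, are solved
for the strand `c`. -/
theorem slideCap_iff :
    topLeft z k b c = a.bar ↔ c = (topRight z k.inv a b).bar := by
  constructor
  · intro h
    have h1 := topRight_slideCup' z k.inv c b
    rw [Crossing.inv_inv, h, bar_bar] at h1
    rw [h1, bar_bar]
  · rintro rfl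
    have h1 := topLeft_slideCup z k.inv a.bar b
    rwa [Crossing.inv_inv, bar_bar] at h1

theorem topRight_slideCap (h : topLeft z k b c = a.bar) :
    topRight z k b c = topLeft z k.inv a b := by
  have h1 := topLeft_slideCup' z k.inv c b
  rw [Crossing.inv_inv, h, bar_bar] at h1
  exact h1.symm

/-- The equation for the arc closed up by a curl. Over and under strand have the same label there,
so both classical kinds lead to the same solution: a power of the unit times the incoming value. -/
theorem topRight_eq_iff :
    topRight z k a b = b ↔ b = match k with
      | .virt => a
      | _ => ⟨a.up, a.label, z a.label ^ sgn a.up • a.val⟩ := by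
  cases k
  · simp only [topRight, Tint.ext_iff]
    constructor
    · rintro ⟨h1, h2, h3⟩
      refine ⟨h1.symm, h2.symm, ?_⟩
      rw [add_comm, add_sub_assoc, add_eq_left, sub_eq_zero, zpow_neg, eq_inv_smul_iff] at h3
      exact h3.symm
    · rintro ⟨h1, h2, h3⟩
      refine ⟨h1.symm, h2.symm, ?_⟩
      simp [h3]
  · simp only [topRight, Tint.ext_iff]
    constructor <;> rintro ⟨h1, h2, h3⟩
    · exact ⟨h1.symm, h2.symm, by rw [← h3]; simp [h1, h2]⟩
    · exact ⟨h1.symm, h2.symm, by simp [h1, h2, h3]⟩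
  · exact eq_comm

theorem topLeft_eq_iff :
    topLeft z k a b = a ↔ a = match k with
      | .virt => b
      | _ => ⟨b.up, b.label, z b.label ^ (-sgn b.up) • b.val⟩ := by
  cases k
  · simp only [topLeft, Tint.ext_iff]
    constructor <;> rintro ⟨h1, h2, h3⟩
    · exact ⟨h1.symm, h2.symm, by rw [← h3]; simp [h1, h2]⟩
    · exact ⟨h1.symm, h2.symm, by simp [h1, h2, h3]⟩
  · simp only [topLeft, Tint.ext_iff]
    constructor
    · rintro ⟨h1, h2, h3⟩
      refine ⟨h1.symm, h2.symm, ?_⟩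
      rw [add_comm, add_sub_assoc, add_eq_left, sub_eq_zero] at h3
      rw [h3]; simp
    · rintro ⟨h1, h2, h3⟩
      refine ⟨h1.symm, h2.symm, ?_⟩
      simp [h3]
  · exact eq_comm

/-- A curl is invisible from outside: the unit picked up on the loop cancels when the strand leaves.
-/
theorem topLeft_of_topRight_eq (h : topRight z k a b = b) : topLeft z k a b = a := by
  rw [topRight_eq_iff] at h
  subst h
  cases k <;> simp [topLeft]

theorem topRight_of_topLeft_eq (h : topLeft z k a b = a) : topRight z k a b = b := by
  rw [topLeft_eq_iff] at h
  subst h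
  cases k <;> simp [topRight]

theorem existsUnique_topRight_eq : ∃! b, topRight z k a b = b := by
  simp only [topRight_eq_iff, existsUnique_eq]

theorem existsUnique_topLeft_eq : ∃! a, topLeft z k a b = a := by
  simp only [topLeft_eq_iff, existsUnique_eq]

/-- Each crossing preserves the sum of the two values, and the units of different circles commute.
In the forbidden move the over strand collects `f - Z f` from each of the other two, in either
order, and the virtual crossing merely swaps them. -/
theorem triangle {i j k : Crossing} (h : Triangle i j k) :
    topLeft z k (topLeft z i a b) (topLeft z j (topRight z i a b) c) =
        topLeft z j a (topLeft z k b c) ∧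
      topRight z k (topLeft z i a b) (topLeft z j (topRight z i a b) c) =
        topLeft z i (topRight z j a (topLeft z k b c)) (topRight z k b c) ∧
      topRight z j (topRight z i a b) c =
        topRight z i (topRight z j a (topLeft z k b c)) (topRight z k b c) := by
  cases h with
  | reidemeister ha hb hc h =>
    cases i <;> cases j <;> cases k <;> simp at ha hb hc h <;>
    refine ⟨?_, ?_, ?_⟩ <;>
    simp only [topLeft, topRight, smul_sub, smul_add, zpow_neg, smul_inv_smul, inv_smul_smul,
      Tint.mk.injEq, true_and]
    -- A strand below both others is multiplied by their units in the two possible orders;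
    -- commutativity of `R` identifies the products.
    all_goals try simp only [smul_smul, mul_comm, inv_mul_cancel_left, mul_inv_cancel_comm_assoc]
    all_goals abel
  | virtual₁ => cases k <;> simp [topLeft, topRight]
  | virtual₂ => cases j <;> simp [topLeft, topRight]
  | virtual₃ => cases i <;> simp [topLeft, topRight]
  | over₁ => simp [topLeft, topRight]; abel
  | over₂ => simp [topLeft, topRight]; abel
  | over₃ => simp [topLeft, topRight]; abel

end Tint
-- Reading a word on coloured strands
section Runs

variable {R S M S' M' : Type*} [CommRing R] [AddCommGroup M] [Module R M]
  [AddCommGroup M'] [Module R M']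

/-- Strands below and above an event. -/
inductive Event.Tinted (z : S → Rˣ) : Event → List (Tint S M) → List (Tint S M) → Prop
  | cup (a : Tint S M) : Tinted z (.cup a.up) [] [a, a.bar]
  | cap (a : Tint S M) : Tinted z .cap [a, a.bar] []
  | cross (k : Crossing) (a b : Tint S M) :
      Tinted z (.cross k) [a, b] [a.topLeft z k b, a.topRight z k b]

/-- The strands `σ` on the line below an event at position `i`, the strands `τ` on the line above
it, and the strands `y` starting at it. -/
inductive EventAt (z : S → Rˣ) :
    ℕ → Event → List (Tint S M) → List (Tint S M) → List (Tint S M) → Prop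
  | zero {e : Event} {x y : List (Tint S M)} (h : e.Tinted z x y) (ρ : List (Tint S M)) :
      EventAt z 0 e y (x ++ ρ) (y ++ ρ)
  | succ {i : ℕ} {e : Event} {y σ τ : List (Tint S M)} (a : Tint S M)
      (h : EventAt z i e y σ τ) : EventAt z (i + 1) e y (a :: σ) (a :: τ)

/-- The strands `σ` and `τ` on lines below and above the events `w`, and for each of the events
the list of strands starting at it. -/
inductive Run (z : S → Rˣ) :
    List (Tint S M) → List Slice → List (List (Tint S M)) → List (Tint S M) → Prop
  | nil (σ : List (Tint S M)) : Run z σ [] [] σ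
  | cons {i : ℕ} {e : Event} {y σ ρ τ : List (Tint S M)} {w : List Slice}
      {ys : List (List (Tint S M))} (h : EventAt z i e y σ ρ) (h' : Run z ρ w ys τ) :
      Run z σ (⟨i, e⟩ :: w) (y :: ys) τ

variable {z : S → Rˣ} {z' : S' → Rˣ}

theorem run_nil_iff {σ τ : List (Tint S M)} {ys : List (List (Tint S M))} :
    Run z σ [] ys τ ↔ ys = [] ∧ σ = τ :=
  ⟨fun h => by cases h; exact ⟨rfl, rfl⟩, by rintro ⟨rfl, rfl⟩; exact .nil σ⟩

theorem run_cons_iff {i : ℕ} {e : Event} {σ τ : List (Tint S M)} {w : List Slice}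
    {ys : List (List (Tint S M))} :
    Run z σ (⟨i, e⟩ :: w) ys τ ↔
      ∃ y zs ρ, ys = y :: zs ∧ EventAt z i e y σ ρ ∧ Run z ρ w zs τ :=
  ⟨fun h => by cases h with | cons h h' => exact ⟨_, _, _, rfl, h, h'⟩,
    by rintro ⟨y, zs, ρ, rfl, h, h'⟩; exact .cons h h'⟩

theorem eventAt_zero_iff {e : Event} {y σ τ : List (Tint S M)} :
    EventAt z 0 e y σ τ ↔ ∃ x ρ, σ = x ++ ρ ∧ τ = y ++ ρ ∧ e.Tinted z x y :=
  ⟨fun h => by cases h with | zero h ρ => exact ⟨_, ρ, rfl, rfl, h⟩,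
    by rintro ⟨x, ρ, rfl, rfl, h⟩; exact .zero h ρ⟩

theorem eventAt_succ_iff {i : ℕ} {e : Event} {y σ τ : List (Tint S M)} :
    EventAt z (i + 1) e y σ τ ↔ ∃ a σ' τ', σ = a :: σ' ∧ τ = a :: τ' ∧ EventAt z i e y σ' τ' :=
  ⟨fun h => by cases h with | succ a h => exact ⟨a, _, _, rfl, rfl, h⟩,
    by rintro ⟨a, σ', τ', rfl, rfl, h⟩; exact .succ a h⟩

theorem cup_iff {d : Bool} {y σ τ : List (Tint S M)} :
    EventAt z 0 (.cup d) y σ τ ↔ ∃ a, a.up = d ∧ y = [a, a.bar] ∧ τ = a :: a.bar :: σ := by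
  rw [eventAt_zero_iff]
  constructor
  · rintro ⟨x, ρ, rfl, rfl, h⟩
    cases h with | cup a => exact ⟨a, rfl, rfl, rfl⟩
  · rintro ⟨a, rfl, rfl, rfl⟩
    exact ⟨[], σ, rfl, rfl, .cup a⟩

theorem cap_iff {y σ τ : List (Tint S M)} :
    EventAt z 0 .cap y σ τ ↔ y = [] ∧ ∃ a, σ = a :: a.bar :: τ := by
  rw [eventAt_zero_iff]
  constructor
  · rintro ⟨x, ρ, rfl, rfl, h⟩
    cases h with | cap a => exact ⟨rfl, a, rfl⟩
  · rintro ⟨rfl, a, rfl⟩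
    exact ⟨[a, a.bar], τ, rfl, rfl, .cap a⟩

theorem cross_iff {k : Crossing} {y σ τ : List (Tint S M)} :
    EventAt z 0 (.cross k) y σ τ ↔ ∃ a b ρ, σ = a :: b :: ρ ∧
      y = [a.topLeft z k b, a.topRight z k b] ∧
      τ = a.topLeft z k b :: a.topRight z k b :: ρ := by
  rw [eventAt_zero_iff]
  constructor
  · rintro ⟨x, ρ, rfl, rfl, h⟩
    cases h with | cross k a b => exact ⟨a, b, ρ, rfl, rfl, rfl⟩
  · rintro ⟨a, b, ρ, rfl, rfl, rfl⟩
    exact ⟨[a, b], ρ, rfl, rfl, .cross k a b⟩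

namespace EventAt

variable {i : ℕ} {e : Event} {y σ τ : List (Tint S M)}

theorem le_length (h : EventAt z i e y σ τ) : i ≤ σ.length := by
  induction h with
  | zero => exact Nat.zero_le _
  | succ a h ih => simpa using ih

theorem tops_eq (h : EventAt z i e y σ τ) : y = (τ.drop i).take e.outs := by
  induction h with
  | zero h ρ => cases h <;> rfl
  | succ a h ih => simpa using ih

/-- The only free choice at an event is the colour created at a minimum, and `y` records it. -/
theorem det (h : EventAt z i e y σ τ) {τ' : List (Tint S M)} (h' : EventAt z i e y σ τ') :
    τ = τ' := by
  induction h generalizing τ' with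
  | zero h ρ =>
    cases h with
    | cup a =>
      obtain ⟨b, -, h1, rfl⟩ := cup_iff.1 h'
      simp_all
    | cap a =>
      obtain ⟨-, b, h1⟩ := cap_iff.1 h'
      simp_all
    | cross k a b =>
      obtain ⟨a', b', ρ', h1, -, rfl⟩ := cross_iff.1 h'
      simp_all
  | succ a h ih =>
    obtain ⟨_, _, _, h1, rfl, h2⟩ := eventAt_succ_iff.1 h'
    simp only [List.cons.injEq] at h1
    obtain ⟨rfl, rfl⟩ := h1
    rw [ih h2]

theorem append_iff {l : List (Tint S M)} {m : ℕ} :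
    EventAt z (l.length + m) e y (l ++ σ) τ ↔ ∃ τ', τ = l ++ τ' ∧ EventAt z m e y σ τ' := by
  induction l generalizing τ with
  | nil => simp
  | cons a l ih =>
    rw [List.length_cons, Nat.add_right_comm, List.cons_append, eventAt_succ_iff]
    simp only [List.cons.injEq, List.cons_append]
    constructor
    · rintro ⟨b, σ', τ', ⟨rfl, rfl⟩, rfl, h⟩
      obtain ⟨τ'', rfl, h''⟩ := ih.1 h
      exact ⟨τ'', rfl, h''⟩
    · rintro ⟨τ', rfl, h⟩
      exact ⟨a, _, _, ⟨rfl, rfl⟩, rfl, ih.2 ⟨τ', rfl, h⟩⟩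

theorem append_iff_zero {l : List (Tint S M)} :
    EventAt z l.length e y (l ++ σ) τ ↔ ∃ τ', τ = l ++ τ' ∧ EventAt z 0 e y σ τ' :=
  append_iff (m := 0)

end EventAt

/-- A map of labels and a map of values. -/
@[simps] def Tint.map (f : S → S') (g : M →+ M') (a : Tint S M) : Tint S' M' :=
  ⟨a.up, f a.label, g a.val⟩

section Map

variable {f : S → S'} {g : M →+ M'}

theorem Tint.map_bar (a : Tint S M) : a.bar.map f g = (a.map f g).bar := by
  ext <;> simp

theorem map_zpow_smul (hg : ∀ s m, g (z s • m) = z' (f s) • g m) (s : S) (m : M) (u : Bool) :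
    g (z s ^ sgn u • m) = z' (f s) ^ sgn u • g m := by
  cases u
  · simp only [sgn, Bool.false_eq_true, if_false, zpow_neg, zpow_one]
    rw [eq_inv_smul_iff, ← hg, smul_inv_smul]
  · simp [sgn, hg]

theorem map_zpow_neg_smul (hg : ∀ s m, g (z s • m) = z' (f s) • g m) (s : S) (m : M) (u : Bool) :
    g (z s ^ (-sgn u) • m) = z' (f s) ^ (-sgn u) • g m := by
  rw [← Tint.sgn_not, map_zpow_smul hg]

theorem Tint.map_topLeft (hg : ∀ s m, g (z s • m) = z' (f s) • g m) (k : Crossing)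
    (a b : Tint S M) :
    (a.topLeft z k b).map f g = (a.map f g).topLeft z' k (b.map f g) := by
  cases k <;> ext <;> simp only [topLeft, map, map_sub, map_add, map_zpow_smul hg,
    map_zpow_neg_smul hg]

theorem Tint.map_topRight (hg : ∀ s m, g (z s • m) = z' (f s) • g m) (k : Crossing)
    (a b : Tint S M) :
    (a.topRight z k b).map f g = (a.map f g).topRight z' k (b.map f g) := by
  cases k <;> ext <;> simp only [topRight, map, map_sub, map_add, map_zpow_smul hg,
    map_zpow_neg_smul hg]

/-- The rules use nothing but addition and the units, so an additive `g` that intertwines `z` with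
`z'` suffices. -/
theorem EventAt.map (hg : ∀ s m, g (z s • m) = z' (f s) • g m) {i : ℕ} {e : Event}
    {y σ τ : List (Tint S M)} (h : EventAt z i e y σ τ) :
    EventAt z' i e (y.map (Tint.map f g)) (σ.map (Tint.map f g)) (τ.map (Tint.map f g)) := by
  induction h with
  | zero h ρ =>
    rw [List.map_append, List.map_append]
    refine .zero ?_ _
    cases h with
    | cup a => simpa [Tint.map_bar] using Event.Tinted.cup (z := z') (a.map f g)
    | cap a => simpa [Tint.map_bar] using Event.Tinted.cap (z := z') (a.map f g)
    | cross k a b =>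
      simpa [Tint.map_topLeft hg, Tint.map_topRight hg] using
        Event.Tinted.cross (z := z') k (a.map f g) (b.map f g)
  | succ a h ih => exact .succ _ ih

theorem Run.map (hg : ∀ s m, g (z s • m) = z' (f s) • g m)
    {σ τ : List (Tint S M)} {w : List Slice} {ys : List (List (Tint S M))} (h : Run z σ w ys τ) :
    Run z' (σ.map (Tint.map f g)) w (ys.map (List.map (Tint.map f g)))
      (τ.map (Tint.map f g)) := by
  induction h with
  | nil => exact .nil _
  | cons h _ ih => exact .cons (h.map hg) ih

end Map

namespace Run

variable {σ ρ τ : List (Tint S M)} {w w' : List Slice} {ys zs : List (List (Tint S M))}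

theorem length_eq (h : Run z σ w ys τ) : ys.length = w.length := by
  induction h with
  | nil => rfl
  | cons _ _ ih => simp [ih]

theorem det (h : Run z σ w ys τ) {τ' : List (Tint S M)} (h' : Run z σ w ys τ') : τ = τ' := by
  induction h with
  | nil => exact (run_nil_iff.1 h').2
  | cons h _ ih =>
    obtain ⟨_, _, _, h1, h2, h3⟩ := run_cons_iff.1 h'
    simp only [List.cons.injEq] at h1
    obtain ⟨rfl, rfl⟩ := h1
    obtain rfl := h.det h2
    exact ih h3

theorem append (h : Run z σ w ys ρ) (h' : Run z ρ w' zs τ) :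
    Run z σ (w ++ w') (ys ++ zs) τ := by
  induction h with
  | nil => exact h'
  | cons h _ ih => exact .cons h (ih h')

theorem exists_of_append (h : Run z σ (w ++ w') ys τ) :
    ∃ us vs ρ, ys = us ++ vs ∧ Run z σ w us ρ ∧ Run z ρ w' vs τ := by
  induction w generalizing σ ys with
  | nil => exact ⟨[], ys, σ, rfl, .nil σ, h⟩
  | cons s w ih =>
    obtain ⟨y, zs, ρ, rfl, h1, h2⟩ := run_cons_iff.1 h
    obtain ⟨us, vs, ρ', rfl, h3, h4⟩ := ih h2
    exact ⟨y :: us, vs, ρ', rfl, .cons h1 h3, h4⟩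

end Run

end Runs

/-! ### Local moves acting on coloured strands -/

/-- The local moves at the left end of a line. -/
inductive BaseMove : List Slice → List Slice → Prop
  | exchange (m : ℕ) (a b : Event) : BaseMove [⟨0, a⟩, ⟨a.outs + m, b⟩] [⟨a.ins + m, b⟩, ⟨0, a⟩]
  | zigzagRight (d : Bool) : BaseMove [⟨1, .cup d⟩, ⟨0, .cap⟩] []
  | zigzagLeft (d : Bool) : BaseMove [⟨0, .cup d⟩, ⟨1, .cap⟩] []
  | slideCup (d : Bool) (k : Crossing) :
      BaseMove [⟨0, .cup d⟩, ⟨1, .cross k⟩] [⟨1, .cup d⟩, ⟨0, .cross k.inv⟩]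
  | slideCap (k : Crossing) : BaseMove [⟨1, .cross k⟩, ⟨0, .cap⟩] [⟨0, .cross k.inv⟩, ⟨1, .cap⟩]
  | curlRight (d : Bool) (k : Crossing) :
      BaseMove [⟨1, .cup d⟩, ⟨0, .cross k⟩, ⟨1, .cap⟩] []
  | curlLeft (d : Bool) (k : Crossing) :
      BaseMove [⟨0, .cup d⟩, ⟨1, .cross k⟩, ⟨0, .cap⟩] []
  | bigon (k : Crossing) : BaseMove [⟨0, .cross k⟩, ⟨0, .cross k.inv⟩] []
  | triangle {a b c : Crossing} (h : Triangle a b c) :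
      BaseMove [⟨0, .cross a⟩, ⟨1, .cross b⟩, ⟨0, .cross c⟩]
        [⟨1, .cross c⟩, ⟨0, .cross b⟩, ⟨1, .cross a⟩]

section Moves

variable {R S M : Type*} [CommRing R] [AddCommGroup M] [Module R M] {z : S → Rˣ}
  {A B : List Slice} {σ τ : List (Tint S M)} {ys zs : List (List (Tint S M))}

/-- The strand without its colours. -/
@[simps] def Tint.bare (a : Tint S M) : Tint Unit Unit := ⟨a.up, (), ()⟩

/-- The events fit the orientations of the strands. -/
def Fits (R : Type*) [CommRing R] (w : List Slice) (σ : List (Tint S M)) : Prop :=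
  ∃ ys τ, Run (1 : Unit → Rˣ) (σ.map Tint.bare) w ys τ

theorem eventAt_one_iff {e : Event} {y σ τ : List (Tint S M)} :
    EventAt z 1 e y σ τ ↔ ∃ a σ' τ', σ = a :: σ' ∧ τ = a :: τ' ∧ EventAt z 0 e y σ' τ' :=
  eventAt_succ_iff

theorem exists_append_of_eventAt {i : ℕ} {e : Event} {y : List (Tint S M)}
    (h : EventAt z i e y σ τ) : ∃ l σ' τ', σ = l ++ σ' ∧ τ = l ++ τ' ∧ l.length = i ∧
      EventAt z 0 e y σ' τ' := by
  induction h with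
  | zero h ρ => exact ⟨[], _, _, rfl, rfl, rfl, .zero h ρ⟩
  | succ a h ih =>
    obtain ⟨l, σ', τ', rfl, rfl, rfl, h'⟩ := ih
    exact ⟨a :: l, σ', τ', rfl, rfl, rfl, h'⟩

theorem Event.Tinted.length_eq {e : Event} {x y : List (Tint S M)} (h : e.Tinted z x y) :
    x.length = e.ins ∧ y.length = e.outs := by
  cases h <;> exact ⟨rfl, rfl⟩

/-- Events on disjoint groups of strands: both orders are described by the same data, only the lists
of starting strands come in opposite order. -/
theorem run_exchange_iff {m : ℕ} {a b : Event} :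
    Run z σ [⟨0, a⟩, ⟨a.outs + m, b⟩] ys τ ↔ ∃ x y y' ρ ρ', a.Tinted z x y ∧
      EventAt z m b y' ρ ρ' ∧ σ = x ++ ρ ∧ τ = y ++ ρ' ∧ ys = [y, y'] := by
  simp only [run_cons_iff, run_nil_iff, eventAt_zero_iff]
  constructor
  · rintro ⟨y, _, _, rfl, ⟨x, ρ, rfl, rfl, h⟩, y', _, _, rfl, h', rfl, rfl⟩
    rw [← h.length_eq.2, EventAt.append_iff] at h'
    obtain ⟨ρ', rfl, h'⟩ := h'
    exact ⟨x, y, y', ρ, ρ', h, h', rfl, rfl, rfl⟩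
  · rintro ⟨x, y, y', ρ, ρ', h, h', rfl, rfl, rfl⟩
    refine ⟨y, _, _, rfl, ⟨x, ρ, rfl, rfl, h⟩, y', _, _, rfl, ?_, rfl, rfl⟩
    rw [← h.length_eq.2, EventAt.append_iff]
    exact ⟨ρ', rfl, h'⟩

theorem run_exchange_iff' {m : ℕ} {a b : Event} :
    Run z σ [⟨a.ins + m, b⟩, ⟨0, a⟩] ys τ ↔ ∃ x y y' ρ ρ', a.Tinted z x y ∧
      EventAt z m b y' ρ ρ' ∧ σ = x ++ ρ ∧ τ = y ++ ρ' ∧ ys = [y', y] := by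
  simp only [run_cons_iff, run_nil_iff, eventAt_zero_iff]
  constructor
  · rintro ⟨y', _, _, rfl, h', y, _, _, rfl, ⟨x, ρ', rfl, rfl, h⟩, rfl, rfl⟩
    obtain ⟨l, σ', τ', rfl, h3, hl, -⟩ := exists_append_of_eventAt h'
    -- The event `b` sits at position `a.ins + m`, so the strands used by `a` are among those
    -- passing on its left.
    obtain ⟨l, l', rfl, hl'⟩ : ∃ l₁ l₂, l = l₁ ++ l₂ ∧ l₁.length = a.ins :=
      ⟨l.take a.ins, l.drop a.ins, by simp, by simp; omega⟩
    rw [List.append_assoc] at h3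
    obtain ⟨rfl, rfl⟩ := List.append_inj h3 (h.length_eq.1.trans hl'.symm)
    rw [← h.length_eq.1, List.append_assoc, EventAt.append_iff] at h'
    obtain ⟨ρ', h4, h'⟩ := h'
    obtain rfl := List.append_cancel_left h4
    exact ⟨x, y, y', _, _, h, h', by simp, rfl, rfl⟩
  · rintro ⟨x, y, y', ρ, ρ', h, h', rfl, rfl, rfl⟩
    refine ⟨y', _, x ++ ρ', rfl, ?_, y, _, _, rfl, ⟨x, ρ', rfl, rfl, h⟩, rfl, rfl⟩
    rw [← h.length_eq.1, EventAt.append_iff]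
    exact ⟨ρ', rfl, h'⟩

theorem run_zigzagRight_iff {d : Bool} : Run z σ [⟨1, .cup d⟩, ⟨0, .cap⟩] ys τ ↔
    ∃ a ρ, a.up = (!d) ∧ σ = a :: ρ ∧ τ = a :: ρ ∧ ys = [[a.bar, a], []] := by
  simp [run_cons_iff, run_nil_iff, eventAt_one_iff, cup_iff, cap_iff]
  grind

theorem run_zigzagLeft_iff {d : Bool} : Run z σ [⟨0, .cup d⟩, ⟨1, .cap⟩] ys τ ↔
    ∃ a ρ, a.up = d ∧ σ = a :: ρ ∧ τ = a :: ρ ∧ ys = [[a, a.bar], []] := by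
  simp [run_cons_iff, run_nil_iff, eventAt_one_iff, cup_iff, cap_iff]
  grind

theorem run_slideCup_iff {d : Bool} {k : Crossing} :
    Run z σ [⟨0, .cup d⟩, ⟨1, .cross k⟩] ys τ ↔ ∃ a b ρ, a.up = d ∧ σ = b :: ρ ∧
      τ = a :: a.bar.topLeft z k b :: a.bar.topRight z k b :: ρ ∧
      ys = [[a, a.bar], [a.bar.topLeft z k b, a.bar.topRight z k b]] := by
  simp [run_cons_iff, run_nil_iff, eventAt_one_iff, cup_iff, cross_iff]
  grind

theorem run_slideCup_iff' {d : Bool} {k : Crossing} :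
    Run z σ [⟨1, .cup d⟩, ⟨0, .cross k⟩] ys τ ↔ ∃ a b ρ, a.up = d ∧ σ = b :: ρ ∧
      τ = b.topLeft z k a :: b.topRight z k a :: a.bar :: ρ ∧
      ys = [[a, a.bar], [b.topLeft z k a, b.topRight z k a]] := by
  simp [run_cons_iff, run_nil_iff, eventAt_one_iff, cup_iff, cross_iff]
  grind

theorem run_slideCap_iff {k : Crossing} :
    Run z σ [⟨1, .cross k⟩, ⟨0, .cap⟩] ys τ ↔ ∃ a b c ρ, σ = a :: b :: c :: ρ ∧
      b.topLeft z k c = a.bar ∧ τ = b.topRight z k c :: ρ ∧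
      ys = [[b.topLeft z k c, b.topRight z k c], []] := by
  simp [run_cons_iff, run_nil_iff, eventAt_one_iff, cap_iff, cross_iff]
  grind

theorem run_slideCap_iff' {k : Crossing} :
    Run z σ [⟨0, .cross k⟩, ⟨1, .cap⟩] ys τ ↔ ∃ a b c ρ, σ = a :: b :: c :: ρ ∧
      c = (a.topRight z k b).bar ∧ τ = a.topLeft z k b :: ρ ∧
      ys = [[a.topLeft z k b, a.topRight z k b], []] := by
  simp [run_cons_iff, run_nil_iff, eventAt_one_iff, cap_iff, cross_iff]
  grind

/-- The maximum closes the arc precisely when its colour is a fixed point of the crossing, and then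
the strand leaves as it entered. -/
theorem run_curlRight_iff {d : Bool} {k : Crossing} :
    Run z σ [⟨1, .cup d⟩, ⟨0, .cross k⟩, ⟨1, .cap⟩] ys τ ↔ ∃ a b ρ, a.up = d ∧ σ = b :: ρ ∧
      b.topRight z k a = a ∧ τ = σ ∧ ys = [[a, a.bar], [b, a], []] := by
  simp [run_cons_iff, run_nil_iff, eventAt_one_iff, cup_iff, cap_iff, cross_iff]
  constructor
  · rintro ⟨b, ρ, a, rfl, ⟨rfl, rfl⟩, h, rfl⟩
    have h := (Tint.bar_injective h).symm
    have h' := Tint.topLeft_of_topRight_eq z k b a h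
    exact ⟨a, rfl, b, ⟨ρ, rfl⟩, h, by rw [h'], by rw [h, h']⟩
  · rintro ⟨a, rfl, b, ⟨ρ, rfl⟩, h, rfl, rfl⟩
    have h' := Tint.topLeft_of_topRight_eq z k b a h
    exact ⟨b, ρ, a, by rw [h, h'], ⟨rfl, rfl⟩, by rw [h], by rw [h']⟩

theorem run_curlLeft_iff {d : Bool} {k : Crossing} :
    Run z σ [⟨0, .cup d⟩, ⟨1, .cross k⟩, ⟨0, .cap⟩] ys τ ↔ ∃ a b ρ, a.up = d ∧ σ = b :: ρ ∧
      a.bar.topLeft z k b = a.bar ∧ τ = σ ∧ ys = [[a, a.bar], [a.bar, b], []] := by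
  simp [run_cons_iff, run_nil_iff, eventAt_one_iff, cup_iff, cap_iff, cross_iff]
  constructor
  · rintro ⟨a, b, rfl, rfl, ρ, rfl, h, rfl⟩
    have h' := Tint.topRight_of_topLeft_eq z k a.bar b h
    exact ⟨a, rfl, b, ⟨ρ, rfl⟩, h, by rw [h'], by rw [h, h']⟩
  · rintro ⟨a, rfl, b, ⟨ρ, rfl⟩, h, rfl, rfl⟩
    have h' := Tint.topRight_of_topLeft_eq z k a.bar b h
    exact ⟨a, b, by rw [h, h'], rfl, ρ, rfl, h, by rw [h']⟩

theorem run_bigon_iff {k : Crossing} :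
    Run z σ [⟨0, .cross k⟩, ⟨0, .cross k.inv⟩] ys τ ↔ ∃ a b ρ, σ = a :: b :: ρ ∧ τ = σ ∧
      ys = [[a.topLeft z k b, a.topRight z k b], [a, b]] := by
  simp [run_cons_iff, run_nil_iff, cross_iff, Tint.topLeft_bigon, Tint.topRight_bigon]
  grind

theorem run_triangle_iff {i j k : Crossing} :
    Run z σ [⟨0, .cross i⟩, ⟨1, .cross j⟩, ⟨0, .cross k⟩] ys τ ↔ ∃ a b c ρ, σ = a :: b :: c :: ρ ∧
      τ = Tint.topLeft z k (a.topLeft z i b) (Tint.topLeft z j (a.topRight z i b) c) ::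
        Tint.topRight z k (a.topLeft z i b) (Tint.topLeft z j (a.topRight z i b) c) ::
        Tint.topRight z j (a.topRight z i b) c :: ρ ∧
      ys = [[a.topLeft z i b, a.topRight z i b],
        [Tint.topLeft z j (a.topRight z i b) c, Tint.topRight z j (a.topRight z i b) c],
        [Tint.topLeft z k (a.topLeft z i b) (Tint.topLeft z j (a.topRight z i b) c),
          Tint.topRight z k (a.topLeft z i b) (Tint.topLeft z j (a.topRight z i b) c)]] := by
  simp [run_cons_iff, run_nil_iff, eventAt_one_iff, cross_iff]
  grind

theorem run_triangle_iff' {i j k : Crossing} :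
    Run z σ [⟨1, .cross k⟩, ⟨0, .cross j⟩, ⟨1, .cross i⟩] ys τ ↔ ∃ a b c ρ, σ = a :: b :: c :: ρ ∧
      τ = a.topLeft z j (b.topLeft z k c) ::
        Tint.topLeft z i (a.topRight z j (b.topLeft z k c)) (b.topRight z k c) ::
        Tint.topRight z i (a.topRight z j (b.topLeft z k c)) (b.topRight z k c) :: ρ ∧
      ys = [[b.topLeft z k c, b.topRight z k c],
        [a.topLeft z j (b.topLeft z k c), a.topRight z j (b.topLeft z k c)],
        [Tint.topLeft z i (a.topRight z j (b.topLeft z k c)) (b.topRight z k c),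
          Tint.topRight z i (a.topRight z j (b.topLeft z k c)) (b.topRight z k c)]] := by
  simp [run_cons_iff, run_nil_iff, eventAt_one_iff, cross_iff]
  grind

/-- `A` is never the empty side, so a run of it already contains whatever `B` needs. -/
theorem BaseMove.run_right (hm : BaseMove A B) (hr : Run z σ A ys τ) : ∃ zs, Run z σ B zs τ := by
  cases hm with
  | exchange m a b =>
    obtain ⟨x, y, y', ρ, ρ', h, h', rfl, rfl, rfl⟩ := run_exchange_iff.1 hr
    exact ⟨_, run_exchange_iff'.2 ⟨x, y, y', ρ, ρ', h, h', rfl, rfl, rfl⟩⟩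
  | zigzagRight d =>
    obtain ⟨a, ρ, -, rfl, rfl, -⟩ := run_zigzagRight_iff.1 hr
    exact ⟨[], .nil _⟩
  | zigzagLeft d =>
    obtain ⟨a, ρ, -, rfl, rfl, -⟩ := run_zigzagLeft_iff.1 hr
    exact ⟨[], .nil _⟩
  | slideCup d k =>
    obtain ⟨a, b, ρ, h, rfl, rfl, -⟩ := run_slideCup_iff.1 hr
    -- The new minimum must have as its right branch the rightmost of the three strands above the
    -- move, which forces this witness.
    exact ⟨_, run_slideCup_iff'.2 ⟨(a.bar.topRight z k b).bar, b, ρ, by simp [h], rfl,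
      by rw [Tint.topLeft_slideCup, Tint.topRight_slideCup, Tint.bar_bar], rfl⟩⟩
  | slideCap k =>
    obtain ⟨a, b, c, ρ, rfl, h, rfl, -⟩ := run_slideCap_iff.1 hr
    exact ⟨_, run_slideCap_iff'.2 ⟨a, b, c, ρ, rfl, (Tint.slideCap_iff z k a b c).1 h,
      by rw [Tint.topRight_slideCap z k a b c h], rfl⟩⟩
  | curlRight d k =>
    obtain ⟨-, -, -, -, -, -, rfl, -⟩ := run_curlRight_iff.1 hr
    exact ⟨[], .nil _⟩
  | curlLeft d k =>
    obtain ⟨-, -, -, -, -, -, rfl, -⟩ := run_curlLeft_iff.1 hr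
    exact ⟨[], .nil _⟩
  | bigon k =>
    obtain ⟨-, -, -, -, rfl, -⟩ := run_bigon_iff.1 hr
    exact ⟨[], .nil _⟩
  | triangle ht =>
    obtain ⟨a, b, c, ρ, rfl, rfl, -⟩ := run_triangle_iff.1 hr
    obtain ⟨h1, h2, h3⟩ := Tint.triangle z a b c ht
    exact ⟨_, run_triangle_iff'.2 ⟨a, b, c, ρ, rfl, by rw [h1, h2, h3], rfl⟩⟩

/-- An empty `B` says nothing about the number or the orientations of the strands; `Fits` supplies
this. -/
theorem BaseMove.run_left (hm : BaseMove A B) (hr : Run z σ B zs τ) (hA : Fits R A σ) :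
    ∃ ys, Run z σ A ys τ := by
  cases hm with
  | exchange m a b =>
    obtain ⟨x, y, y', ρ, ρ', h, h', rfl, rfl, rfl⟩ := run_exchange_iff'.1 hr
    exact ⟨_, run_exchange_iff.2 ⟨x, y, y', ρ, ρ', h, h', rfl, rfl, rfl⟩⟩
  | zigzagRight d =>
    obtain ⟨-, rfl⟩ := run_nil_iff.1 hr
    obtain ⟨_, _, hf⟩ := hA
    obtain ⟨a, ρ, ha, h, -, -⟩ := run_zigzagRight_iff.1 hf
    obtain ⟨a, ρ, rfl, rfl, rfl⟩ := List.map_eq_cons_iff.1 h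
    exact ⟨_, run_zigzagRight_iff.2 ⟨a, ρ, ha, rfl, rfl, rfl⟩⟩
  | zigzagLeft d =>
    obtain ⟨-, rfl⟩ := run_nil_iff.1 hr
    obtain ⟨_, _, hf⟩ := hA
    obtain ⟨a, ρ, ha, h, -, -⟩ := run_zigzagLeft_iff.1 hf
    obtain ⟨a, ρ, rfl, rfl, rfl⟩ := List.map_eq_cons_iff.1 h
    exact ⟨_, run_zigzagLeft_iff.2 ⟨a, ρ, ha, rfl, rfl, rfl⟩⟩
  | slideCup d k =>
    obtain ⟨a, b, ρ, h, rfl, rfl, -⟩ := run_slideCup_iff'.1 hr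
    -- The left branch of the new minimum has to be the leftmost strand above the move.
    exact ⟨_, run_slideCup_iff.2 ⟨b.topLeft z k.inv a, b, ρ, by simp [h], rfl,
      by rw [Tint.topLeft_slideCup', Tint.topRight_slideCup'], rfl⟩⟩
  | slideCap k =>
    obtain ⟨a, b, c, ρ, rfl, h, rfl, -⟩ := run_slideCap_iff'.1 hr
    have h' := (Tint.slideCap_iff z k a b c).2 h
    exact ⟨_, run_slideCap_iff.2 ⟨a, b, c, ρ, rfl, h',
      by rw [Tint.topRight_slideCap z k a b c h'], rfl⟩⟩
  | curlRight d k =>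
    obtain ⟨-, rfl⟩ := run_nil_iff.1 hr
    obtain ⟨_, _, hf⟩ := hA
    obtain ⟨a, b, ρ, ha, h, hb, -, -⟩ := run_curlRight_iff.1 hf
    obtain ⟨b, ρ, rfl, rfl, rfl⟩ := List.map_eq_cons_iff.1 h
    -- The colour of the loop is the fixed point. Crossings preserve orientations, so the loop has
    -- the orientation of `b`, as in the colour-free run, and this matches `d`.
    obtain ⟨c, hc, -⟩ := Tint.existsUnique_topRight_eq z k b
    refine ⟨_, run_curlRight_iff.2 ⟨c, b, ρ, ?_, rfl, hc, rfl, rfl⟩⟩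
    rw [← ha, ← hb, ← hc, Tint.up_topRight, Tint.up_topRight, Tint.bare_up]
  | curlLeft d k =>
    obtain ⟨-, rfl⟩ := run_nil_iff.1 hr
    obtain ⟨_, _, hf⟩ := hA
    obtain ⟨a, b, ρ, ha, h, hb, -, -⟩ := run_curlLeft_iff.1 hf
    obtain ⟨b, ρ, rfl, rfl, rfl⟩ := List.map_eq_cons_iff.1 h
    obtain ⟨c, hc, -⟩ := Tint.existsUnique_topLeft_eq z k b
    refine ⟨_, run_curlLeft_iff.2 ⟨c.bar, b, ρ, ?_, rfl, by simpa using hc, rfl, rfl⟩⟩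
    have h1 := congrArg Tint.up hb
    have h2 := congrArg Tint.up hc
    simp only [Tint.up_topLeft, Tint.bare_up, Tint.bar_up] at h1 h2
    rw [← ha, Tint.bar_up, ← h2, h1, Bool.not_not]
  | bigon k =>
    obtain ⟨-, rfl⟩ := run_nil_iff.1 hr
    obtain ⟨_, _, hf⟩ := hA
    obtain ⟨a, b, ρ, h, -, -⟩ := run_bigon_iff.1 hf
    obtain ⟨a, ρ, rfl, rfl, h'⟩ := List.map_eq_cons_iff.1 h
    obtain ⟨b, ρ, rfl, rfl, rfl⟩ := List.map_eq_cons_iff.1 h'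
    exact ⟨_, run_bigon_iff.2 ⟨a, b, ρ, rfl, rfl, rfl⟩⟩
  | triangle ht =>
    obtain ⟨a, b, c, ρ, rfl, rfl, -⟩ := run_triangle_iff'.1 hr
    obtain ⟨h1, h2, h3⟩ := Tint.triangle z a b c ht
    exact ⟨_, run_triangle_iff.2 ⟨a, b, c, ρ, rfl, by rw [h1, h2, h3], rfl⟩⟩

/-- Interior strands can be read off from the lines below and above the move, except in a curl,
where the fixed point is unique. -/
theorem BaseMove.unique_left (hm : BaseMove A B) (hr : Run z σ A ys τ) (hr' : Run z σ A zs τ) :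
    ys = zs := by
  cases hm with
  | exchange m a b =>
    obtain ⟨x, y, y', ρ, ρ', h, h', rfl, rfl, rfl⟩ := run_exchange_iff.1 hr
    obtain ⟨x₁, y₁, y₁', ρ₁, ρ₁', h₁, h₁', h2, h3, rfl⟩ := run_exchange_iff.1 hr'
    obtain ⟨rfl, rfl⟩ := List.append_inj h3 (h.length_eq.2.trans h₁.length_eq.2.symm)
    rw [h'.tops_eq, h₁'.tops_eq]
  | zigzagRight d =>
    obtain ⟨a, ρ, -, rfl, -, rfl⟩ := run_zigzagRight_iff.1 hr
    obtain ⟨a', ρ', -, h, -, rfl⟩ := run_zigzagRight_iff.1 hr'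
    simp_all
  | zigzagLeft d =>
    obtain ⟨a, ρ, -, rfl, -, rfl⟩ := run_zigzagLeft_iff.1 hr
    obtain ⟨a', ρ', -, h, -, rfl⟩ := run_zigzagLeft_iff.1 hr'
    simp_all
  | slideCup d k =>
    obtain ⟨a, b, ρ, -, rfl, rfl, rfl⟩ := run_slideCup_iff.1 hr
    obtain ⟨a', b', ρ', -, h1, h2, rfl⟩ := run_slideCup_iff.1 hr'
    simp_all
  | slideCap k =>
    obtain ⟨a, b, c, ρ, rfl, -, -, rfl⟩ := run_slideCap_iff.1 hr
    obtain ⟨a', b', c', ρ', h1, -, -, rfl⟩ := run_slideCap_iff.1 hr'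
    simp_all
  | curlRight d k =>
    obtain ⟨a, b, ρ, -, rfl, h1, -, rfl⟩ := run_curlRight_iff.1 hr
    obtain ⟨a', b', ρ', -, h, h2, -, rfl⟩ := run_curlRight_iff.1 hr'
    simp only [List.cons.injEq] at h
    obtain ⟨rfl, rfl⟩ := h
    rw [(Tint.existsUnique_topRight_eq z k b).unique h1 h2]
  | curlLeft d k =>
    obtain ⟨a, b, ρ, -, rfl, h1, -, rfl⟩ := run_curlLeft_iff.1 hr
    obtain ⟨a', b', ρ', -, h, h2, -, rfl⟩ := run_curlLeft_iff.1 hr'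
    simp only [List.cons.injEq] at h
    obtain ⟨rfl, rfl⟩ := h
    rw [Tint.bar_injective ((Tint.existsUnique_topLeft_eq z k b).unique h1 h2)]
  | bigon k =>
    obtain ⟨a, b, ρ, rfl, -, rfl⟩ := run_bigon_iff.1 hr
    obtain ⟨a', b', ρ', h, -, rfl⟩ := run_bigon_iff.1 hr'
    simp_all
  | triangle ht =>
    obtain ⟨a, b, c, ρ, rfl, -, rfl⟩ := run_triangle_iff.1 hr
    obtain ⟨a', b', c', ρ', h, -, rfl⟩ := run_triangle_iff.1 hr'
    simp_all

theorem BaseMove.unique_right (hm : BaseMove A B) (hr : Run z σ B ys τ) (hr' : Run z σ B zs τ) :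
    ys = zs := by
  cases hm with
  | exchange m a b =>
    obtain ⟨x, y, y', ρ, ρ', h, h', rfl, rfl, rfl⟩ := run_exchange_iff'.1 hr
    obtain ⟨x₁, y₁, y₁', ρ₁, ρ₁', h₁, h₁', h2, h3, rfl⟩ := run_exchange_iff'.1 hr'
    obtain ⟨rfl, rfl⟩ := List.append_inj h3 (h.length_eq.2.trans h₁.length_eq.2.symm)
    rw [h'.tops_eq, h₁'.tops_eq]
  | slideCup d k =>
    obtain ⟨a, b, ρ, -, rfl, rfl, rfl⟩ := run_slideCup_iff'.1 hr
    obtain ⟨a', b', ρ', -, h1, h2, rfl⟩ := run_slideCup_iff'.1 hr'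
    simp_all [Tint.bar_injective.eq_iff]
  | slideCap k =>
    obtain ⟨a, b, c, ρ, rfl, -, -, rfl⟩ := run_slideCap_iff'.1 hr
    obtain ⟨a', b', c', ρ', h1, -, -, rfl⟩ := run_slideCap_iff'.1 hr'
    simp_all
  | triangle ht =>
    obtain ⟨a, b, c, ρ, rfl, -, rfl⟩ := run_triangle_iff'.1 hr
    obtain ⟨a', b', c', ρ', h, -, rfl⟩ := run_triangle_iff'.1 hr'
    simp_all
  -- All other moves have an empty right-hand side.
  | _ => rw [(run_nil_iff.1 hr).1, (run_nil_iff.1 hr').1]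

end Moves
-- Moves at an arbitrary position on the line
/-- An event with `i` more strands on its left. -/
def Slice.shift (i : ℕ) (s : Slice) : Slice := ⟨i + s.pos, s.event⟩

theorem Move.exists_baseMove {A B : List Slice} (h : Move A B) :
    ∃ i A₀ B₀, BaseMove A₀ B₀ ∧ A = A₀.map (Slice.shift i) ∧ B = B₀.map (Slice.shift i) := by
  cases h with
  | exchange i m a b =>
    exact ⟨i, _, _, .exchange m a b, by simp [Slice.shift, add_assoc],
      by simp [Slice.shift, add_assoc]⟩
  | zigzagRight i d => exact ⟨i, _, _, .zigzagRight d, rfl, rfl⟩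
  | zigzagLeft i d => exact ⟨i, _, _, .zigzagLeft d, rfl, rfl⟩
  | slideCup i d k => exact ⟨i, _, _, .slideCup d k, rfl, rfl⟩
  | slideCap i k => exact ⟨i, _, _, .slideCap k, rfl, rfl⟩
  | curlRight i d k => exact ⟨i, _, _, .curlRight d k, rfl, rfl⟩
  | curlLeft i d k => exact ⟨i, _, _, .curlLeft d k, rfl, rfl⟩
  | bigon i k => exact ⟨i, _, _, .bigon k, rfl, rfl⟩
  | triangle i h => exact ⟨i, _, _, .triangle h, rfl, rfl⟩

theorem BaseMove.ne_nil {A B : List Slice} (h : BaseMove A B) : A ≠ [] := by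
  cases h <;> simp

section Moves

variable {R S M : Type*} [CommRing R] [AddCommGroup M] [Module R M] {z : S → Rˣ}
  {A B : List Slice} {σ τ : List (Tint S M)} {ys zs : List (List (Tint S M))}

theorem run_shift_iff {l : List (Tint S M)} {w : List Slice} :
    Run z (l ++ σ) (w.map (Slice.shift l.length)) ys τ ↔ ∃ τ', τ = l ++ τ' ∧ Run z σ w ys τ' := by
  induction w generalizing σ ys with
  | nil => simp [run_nil_iff, eq_comm, and_comm]
  | cons s w ih =>
    obtain ⟨i, e⟩ := s
    simp only [List.map_cons, Slice.shift, run_cons_iff, EventAt.append_iff]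
    constructor
    · rintro ⟨y, zs, _, rfl, ⟨ρ, rfl, h⟩, h'⟩
      obtain ⟨τ', rfl, h''⟩ := ih.1 h'
      exact ⟨τ', rfl, y, zs, ρ, rfl, h, h''⟩
    · rintro ⟨τ', rfl, y, zs, ρ, rfl, h, h'⟩
      exact ⟨y, zs, _, rfl, ⟨ρ, rfl, h⟩, ih.2 ⟨τ', rfl, h'⟩⟩

theorem Run.exists_append_of_shift {i : ℕ} {w : List Slice} (hw : w ≠ [])
    (h : Run z σ (w.map (Slice.shift i)) ys τ) : ∃ l σ', σ = l ++ σ' ∧ l.length = i := by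
  obtain ⟨s, w, rfl⟩ := List.exists_cons_of_ne_nil hw
  simp only [List.map_cons, Slice.shift, run_cons_iff] at h
  obtain ⟨y, zs, ρ, -, h, -⟩ := h
  have := h.le_length
  exact ⟨σ.take i, σ.drop i, by simp, by simp; omega⟩

theorem Move.run_right (hm : Move A B) (h : Run z σ A ys τ) : ∃ zs, Run z σ B zs τ := by
  obtain ⟨i, A, B, hm', rfl, rfl⟩ := hm.exists_baseMove
  obtain ⟨l, σ, rfl, rfl⟩ := h.exists_append_of_shift hm'.ne_nil
  obtain ⟨τ, rfl, h₀⟩ := run_shift_iff.1 h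
  obtain ⟨zs, h₁⟩ := hm'.run_right h₀
  exact ⟨zs, run_shift_iff.2 ⟨τ, rfl, h₁⟩⟩

theorem Move.run_left (hm : Move A B) (h : Run z σ B zs τ) (hA : Fits R A σ) :
    ∃ ys, Run z σ A ys τ := by
  obtain ⟨i, A, B, hm', rfl, rfl⟩ := hm.exists_baseMove
  obtain ⟨us, ρ, hA⟩ := hA
  obtain ⟨l, σ', h1, rfl⟩ := hA.exists_append_of_shift hm'.ne_nil
  obtain ⟨l, σ, rfl, rfl, rfl⟩ := List.map_eq_append_iff.1 h1
  rw [List.length_map] at h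
  rw [List.map_append] at hA
  obtain ⟨ρ₁, -, hA₀⟩ := run_shift_iff.1 hA
  obtain ⟨τ, rfl, h₀⟩ := run_shift_iff.1 h
  obtain ⟨ys, h₁⟩ := hm'.run_left h₀ ⟨us, ρ₁, hA₀⟩
  rw [List.length_map]
  exact ⟨ys, run_shift_iff.2 ⟨τ, rfl, h₁⟩⟩

theorem Move.unique_left (hm : Move A B) (h : Run z σ A ys τ) (h' : Run z σ A zs τ) :
    ys = zs := by
  obtain ⟨i, A, B, hm', rfl, rfl⟩ := hm.exists_baseMove
  obtain ⟨l, σ, rfl, rfl⟩ := h.exists_append_of_shift hm'.ne_nil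
  obtain ⟨τ, rfl, h₀⟩ := run_shift_iff.1 h
  obtain ⟨τ', h1, h₀'⟩ := run_shift_iff.1 h'
  obtain rfl := List.append_cancel_left h1
  exact hm'.unique_left h₀ h₀'

theorem Move.unique_right (hm : Move A B) (h : Run z σ B ys τ) (h' : Run z σ B zs τ) :
    ys = zs := by
  obtain ⟨i, A, B, hm', rfl, rfl⟩ := hm.exists_baseMove
  -- An empty side contains no event that would guarantee `i` strands on the left, so it is treated
  -- separately.
  rcases eq_or_ne B [] with rfl | hB
  · rw [(run_nil_iff.1 h).1, (run_nil_iff.1 h').1]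
  obtain ⟨l, σ, rfl, rfl⟩ := h.exists_append_of_shift hB
  obtain ⟨τ, rfl, h₀⟩ := run_shift_iff.1 h
  obtain ⟨τ', h1, h₀'⟩ := run_shift_iff.1 h'
  obtain rfl := List.append_cancel_left h1
  exact hm'.unique_right h₀ h₀'

/-- Without colours, the strands are determined by the orientations. -/
theorem EventAt.bare_det {z : Unit → Rˣ} {i : ℕ} {e : Event} {y y' σ τ τ' : List (Tint Unit Unit)}
    (h : EventAt z i e y σ τ) (h' : EventAt z i e y' σ τ') : y = y' := by
  induction h generalizing τ' with
  | zero h ρ =>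
    cases h with
    | cup a =>
      obtain ⟨b, h1, rfl, -⟩ := cup_iff.1 h'
      obtain rfl : a = b := by ext; simp [h1]
      rfl
    | cap a => exact (cap_iff.1 h').1.symm
    | cross k a b =>
      obtain ⟨a', b', ρ', h1, rfl, -⟩ := cross_iff.1 h'
      simp_all
  | succ a h ih =>
    obtain ⟨_, _, _, h1, rfl, h2⟩ := eventAt_succ_iff.1 h'
    simp only [List.cons.injEq] at h1
    obtain ⟨rfl, rfl⟩ := h1
    exact ih h2

theorem Run.bare_det {z : Unit → Rˣ} {w : List Slice} {ys ys' : List (List (Tint Unit Unit))}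
    {σ τ τ' : List (Tint Unit Unit)} (h : Run z σ w ys τ) (h' : Run z σ w ys' τ') : ys = ys' := by
  induction h generalizing ys' with
  | nil => exact (run_nil_iff.1 h').1.symm
  | cons h _ ih =>
    obtain ⟨_, _, _, rfl, h2, h3⟩ := run_cons_iff.1 h'
    obtain rfl := h.bare_det h2
    obtain rfl := h.det h2
    rw [ih h3]

end Moves

/-! ### Natural bijections between colourings of closed diagrams -/

/-- A natural bijection between the colourings of two closed diagrams. -/
structure Transfer (R : Type) [CommRing R] (w w' : List Slice) : Type 1 where
  rel : ∀ {S M : Type} [AddCommGroup M] [Module R M] (_ : S → Rˣ),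
    List (List (Tint S M)) → List (List (Tint S M)) → Prop
  run_left : ∀ {S M : Type} [AddCommGroup M] [Module R M] {z : S → Rˣ}
    {ys ys' : List (List (Tint S M))}, rel z ys ys' → Run z [] w ys []
  run_right : ∀ {S M : Type} [AddCommGroup M] [Module R M] {z : S → Rˣ}
    {ys ys' : List (List (Tint S M))}, rel z ys ys' → Run z [] w' ys' []
  exists_right : ∀ {S M : Type} [AddCommGroup M] [Module R M] {z : S → Rˣ}
    {ys : List (List (Tint S M))}, Run z [] w ys [] → ∃ ys', rel z ys ys'
  exists_left : ∀ {S M : Type} [AddCommGroup M] [Module R M] {z : S → Rˣ}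
    {ys' : List (List (Tint S M))}, Run z [] w' ys' [] → ∃ ys, rel z ys ys'
  unique_right : ∀ {S M : Type} [AddCommGroup M] [Module R M] {z : S → Rˣ}
    {ys ys' ys'' : List (List (Tint S M))}, rel z ys ys' → rel z ys ys'' → ys' = ys''
  unique_left : ∀ {S M : Type} [AddCommGroup M] [Module R M] {z : S → Rˣ}
    {ys ys' ys'' : List (List (Tint S M))}, rel z ys ys'' → rel z ys' ys'' → ys = ys'
  map : ∀ {S M S' M' : Type} [AddCommGroup M] [Module R M] [AddCommGroup M'] [Module R M']
    {z : S → Rˣ} {z' : S' → Rˣ} {f : S → S'} {g : M →+ M'}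
    (_ : ∀ s m, g (z s • m) = z' (f s) • g m) {ys ys' : List (List (Tint S M))},
    rel z ys ys' → rel z' (ys.map (List.map (Tint.map f g))) (ys'.map (List.map (Tint.map f g)))

namespace Transfer

variable {R : Type} [CommRing R] {w w' w'' : List Slice}

protected def refl (w : List Slice) : Transfer R w w where
  rel z ys ys' := Run z [] w ys [] ∧ ys = ys'
  run_left h := h.1
  run_right h := h.2 ▸ h.1
  exists_right h := ⟨_, h, rfl⟩
  exists_left h := ⟨_, h, rfl⟩
  unique_right h h' := h.2.symm.trans h'.2
  unique_left h h' := h.2.trans h'.2.symm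
  map hg _ _ h := ⟨h.1.map hg, congrArg _ h.2⟩

protected def symm (t : Transfer R w w') : Transfer R w' w where
  rel z ys ys' := t.rel z ys' ys
  run_left := t.run_right
  run_right := t.run_left
  exists_right := t.exists_left
  exists_left := t.exists_right
  unique_right := t.unique_left
  unique_left := t.unique_right
  map hg _ _ h := t.map hg h

protected def trans (t : Transfer R w w') (t' : Transfer R w' w'') : Transfer R w w'' where
  rel z ys ys'' := ∃ ys', t.rel z ys ys' ∧ t'.rel z ys' ys''
  run_left := fun ⟨_, h, _⟩ => t.run_left h
  run_right := fun ⟨_, _, h⟩ => t'.run_right h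
  exists_right h := by
    obtain ⟨ys', h⟩ := t.exists_right h
    obtain ⟨ys'', h'⟩ := t'.exists_right (t.run_right h)
    exact ⟨ys'', ys', h, h'⟩
  exists_left h := by
    obtain ⟨ys', h⟩ := t'.exists_left h
    obtain ⟨ys, h'⟩ := t.exists_left (t'.run_left h)
    exact ⟨ys, ys', h', h⟩
  unique_right := by
    rintro _ _ _ _ _ _ _ _ ⟨_, h1, h2⟩ ⟨_, h3, h4⟩
    obtain rfl := t.unique_right h1 h3
    exact t'.unique_right h2 h4
  unique_left := by
    rintro _ _ _ _ _ _ _ _ ⟨_, h1, h2⟩ ⟨_, h3, h4⟩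
    obtain rfl := t'.unique_left h2 h4
    exact t.unique_left h1 h3
  map hg _ _ := fun ⟨_, h, h'⟩ => ⟨_, t.map hg h, t'.map hg h'⟩

/-- A colouring is cut at the lines just below and just above the move; the outer parts are kept and
the inner one is replaced. The outer parts determine both lines, hence the inner part. -/
theorem of_move {p q A B : List Slice} (hm : Move A B)
    (hA : ∃ ys τ, Run (1 : Unit → Rˣ) ([] : List (Tint Unit Unit)) (p ++ A ++ q) ys τ) :
    Nonempty (Transfer R (p ++ A ++ q) (p ++ B ++ q)) := by
  refine ⟨⟨fun z ys ys' => ∃ us vs vs' ws σ τ, ys = us ++ vs ++ ws ∧ ys' = us ++ vs' ++ ws ∧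
    Run z [] p us σ ∧ Run z σ A vs τ ∧ Run z σ B vs' τ ∧ Run z τ q ws [], ?_, ?_, ?_, ?_, ?_, ?_,
    ?_⟩⟩
  · rintro S M _ _ z _ _ ⟨us, vs, vs', ws, σ, τ, rfl, rfl, h1, h2, h3, h4⟩
    exact (h1.append h2).append h4
  · rintro S M _ _ z _ _ ⟨us, vs, vs', ws, σ, τ, rfl, rfl, h1, h2, h3, h4⟩
    exact (h1.append h3).append h4
  · intro S M _ _ z ys h
    obtain ⟨_, ws, τ, rfl, h1, h2⟩ := h.exists_of_append
    obtain ⟨us, vs, σ, rfl, h1, h3⟩ := h1.exists_of_append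
    obtain ⟨vs', h4⟩ := hm.run_right h3
    exact ⟨_, us, vs, vs', ws, σ, τ, rfl, rfl, h1, h3, h4, h2⟩
  · intro S M _ _ z ys h
    obtain ⟨_, ws, τ, rfl, h1, h2⟩ := h.exists_of_append
    obtain ⟨us, vs, σ, rfl, h1, h3⟩ := h1.exists_of_append
    have hA' : Fits R A σ := by
      obtain ⟨zs, ρ, hA⟩ := hA
      obtain ⟨_, _, _, rfl, hA, -⟩ := hA.exists_of_append
      obtain ⟨_, vs', _, rfl, hp, hA⟩ := hA.exists_of_append
      -- Constant maps forget the colours. The colour-free run of `p` is unique, so the one supplied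
      -- by `hA` ends at the line `σ` stripped of its colours.
      have h5 := h1.map (z' := (1 : Unit → Rˣ)) (f := fun _ => ()) (g := (0 : M →+ Unit))
        (fun _ _ => rfl)
      obtain rfl := hp.bare_det h5
      obtain rfl := hp.det h5
      exact ⟨_, _, hA⟩
    obtain ⟨vs', h4⟩ := hm.run_left h3 hA'
    exact ⟨_, us, vs', vs, ws, σ, τ, rfl, rfl, h1, h4, h3, h2⟩
  · rintro S M _ _ z _ _ _ ⟨us, vs, vs', ws, σ, τ, rfl, rfl, h1, h2, h3, h4⟩
      ⟨us₁, vs₁, vs₁', ws₁, σ₁, τ₁, e, rfl, h1', h2', h3', h4'⟩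
    -- A run has one list per event, so both decompositions cut at the same places.
    obtain ⟨e', rfl⟩ := List.append_inj e
      (by simp [h1.length_eq, h1'.length_eq, h2.length_eq, h2'.length_eq])
    obtain ⟨rfl, rfl⟩ := List.append_inj e' (h1.length_eq.trans h1'.length_eq.symm)
    obtain rfl := h1.det h1'
    obtain rfl := h2.det h2'
    rw [hm.unique_right h3 h3']
  · rintro S M _ _ z _ _ _ ⟨us, vs, vs', ws, σ, τ, rfl, rfl, h1, h2, h3, h4⟩
      ⟨us₁, vs₁, vs₁', ws₁, σ₁, τ₁, rfl, e, h1', h2', h3', h4'⟩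
    obtain ⟨e', rfl⟩ := List.append_inj e
      (by simp [h1.length_eq, h1'.length_eq, h3.length_eq, h3'.length_eq])
    obtain ⟨rfl, rfl⟩ := List.append_inj e' (h1.length_eq.trans h1'.length_eq.symm)
    obtain rfl := h1.det h1'
    obtain rfl := h3.det h3'
    rw [hm.unique_left h2 h2']
  · rintro S M S' M' _ _ _ _ z z' f g hg _ _
      ⟨us, vs, vs', ws, σ, τ, rfl, rfl, h1, h2, h3, h4⟩
    exact ⟨_, _, _, _, _, _, by simp only [List.map_append], by simp only [List.map_append],
      h1.map hg, h2.map hg, h3.map hg, h4.map hg⟩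

end Transfer

/-! ### Inverting the reading of a diagram -/

section Read

theorem exists_of_read_cup {t i : ℕ} {d : Bool} {σ : List Strand} {w : List Slice}
    {vs : List Vertex} (h : read t σ (⟨i, .cup d⟩ :: w) = some vs) :
    ∃ l ρ us, σ = l ++ ρ ∧ l.length = i ∧ vs = .min (t, false) (t, true) :: us ∧
      read (t + 1) (l ++ ⟨(t, false), d⟩ :: ⟨(t, true), !d⟩ :: ρ) w = some us := by
  rw [read] at h
  split_ifs at h with hi
  obtain ⟨us, h', rfl⟩ := Option.map_eq_some_iff.1 h
  exact ⟨_, _, us, (List.take_append_drop i σ).symm, by simp [hi], rfl, h'⟩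

theorem exists_of_read_cap {t i : ℕ} {σ : List Strand} {w : List Slice}
    {vs : List Vertex} (h : read t σ (⟨i, .cap⟩ :: w) = some vs) :
    ∃ l a b ρ us, σ = l ++ a :: b :: ρ ∧ l.length = i ∧ a.up = (!b.up) ∧
      vs = .max a.edge b.edge :: us ∧ read (t + 1) (l ++ ρ) w = some us := by
  rw [read] at h
  split at h
  · rename_i a b ρ hd
    split_ifs at h with hu
    obtain ⟨us, h', rfl⟩ := Option.map_eq_some_iff.1 h
    have hi : i ≤ σ.length := by
      by_contra hi
      rw [List.drop_eq_nil_of_le (by omega)] at hd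
      simp at hd
    exact ⟨_, a, b, ρ, us, by rw [← hd, List.take_append_drop], by simp [hi], hu, rfl, h'⟩
  · simp at h

theorem exists_of_read_cross {t i : ℕ} {k : Crossing} {σ : List Strand} {w : List Slice}
    {vs : List Vertex} (h : read t σ (⟨i, .cross k⟩ :: w) = some vs) :
    ∃ l a b ρ us, σ = l ++ a :: b :: ρ ∧ l.length = i ∧
      vs = .cross k a.up b.up a.edge b.edge (t, false) (t, true) :: us ∧
      read (t + 1) (l ++ ⟨(t, false), b.up⟩ :: ⟨(t, true), a.up⟩ :: ρ) w = some us := by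
  rw [read] at h
  split at h
  · rename_i a b ρ hd
    obtain ⟨us, h', rfl⟩ := Option.map_eq_some_iff.1 h
    have hi : i ≤ σ.length := by
      by_contra hi
      rw [List.drop_eq_nil_of_le (by omega)] at hd
      simp at hd
    exact ⟨_, a, b, ρ, us, by rw [← hd, List.take_append_drop], by simp [hi], rfl, h'⟩
  · simp at h

theorem eq_nil_of_read_nil {t : ℕ} {σ : List Strand} {vs : List Vertex}
    (h : read t σ [] = some vs) : σ = [] ∧ vs = [] := by
  cases σ <;> simp_all [read]

end Read

/-! ### Edge colourings versus runs -/

section Colours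

variable {S M : Type*} {P : EdgeName → Prop} {c : {e // P e} → S × M}

/-- A strand belonging to a coloured edge. -/
@[simps] def Tint.ofEdge (c : {e // P e} → S × M) (u : Bool) (e : {e // P e}) : Tint S M :=
  ⟨u, (c e).1, (c e).2⟩

/-- A strand of a diagram and its coloured version. -/
def Painted (c : {e // P e} → S × M) (s : Strand) (a : Tint S M) : Prop :=
  ∃ h : P s.edge, a = .ofEdge c s.up ⟨s.edge, h⟩

/-- The strands starting at the events from time `t` on have the colours of their edges. -/
def Records (c : {e // P e} → S × M) (t : ℕ) (ys : List (List (Tint S M))) : Prop :=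
  ∀ j a b, ys[j]? = some [a, b] → ∃ e e' : {e // P e}, e.1 = (t + j, false) ∧
    e'.1 = (t + j, true) ∧ a = .ofEdge c a.up e ∧ b = .ofEdge c b.up e'

theorem records_nil (t : ℕ) : Records c t [] := by
  intro j a b h
  simp at h

theorem records_cons_iff {t : ℕ} {y : List (Tint S M)} {ys : List (List (Tint S M))} :
    Records c t (y :: ys) ↔ (∀ a b, y = [a, b] → ∃ e e' : {e // P e}, e.1 = (t, false) ∧
      e'.1 = (t, true) ∧ a = .ofEdge c a.up e ∧ b = .ofEdge c b.up e') ∧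
      Records c (t + 1) ys := by
  constructor
  · intro h
    refine ⟨fun a b hy => h 0 a b (by simp [hy]), fun j a b hj => ?_⟩
    simpa [Nat.add_assoc, Nat.add_comm 1] using h (j + 1) a b (by simpa using hj)
  · rintro ⟨h, h'⟩ j a b hj
    cases j with
    | zero => exact h a b (by simpa using hj)
    | succ j =>
      simpa [Nat.add_assoc, Nat.add_comm 1] using h' j a b (by simpa using hj)

variable {R : Type*} [CommRing R] [AddCommGroup M] [Module R M] {z : S → Rˣ}

/-- The colours of edges obey the relations at the given vertices. -/
structure Respects (z : S → Rˣ) (c : {e // P e} → S × M) (vs : List Vertex) : Prop where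
  min : ∀ l r : {e // P e}, Vertex.min l.1 r.1 ∈ vs → c r = ((c l).1, -(c l).2)
  max : ∀ l r : {e // P e}, Vertex.max l.1 r.1 ∈ vs → c r = ((c l).1, -(c l).2)
  cross : ∀ (k : Crossing) (u v : Bool) (bl br tl tr : {e // P e}),
    Vertex.cross k u v bl.1 br.1 tl.1 tr.1 ∈ vs →
      Tint.ofEdge c v tl = Tint.topLeft z k (.ofEdge c u bl) (.ofEdge c v br) ∧
      Tint.ofEdge c u tr = Tint.topRight z k (.ofEdge c u bl) (.ofEdge c v br)

theorem Respects.mono {vs us : List Vertex} (h : Respects z c vs) (hs : us ⊆ vs) :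
    Respects z c us :=
  ⟨fun l r hv => h.min l r (hs hv), fun l r hv => h.max l r (hs hv),
    fun k u v bl br tl tr hv => h.cross k u v bl br tl tr (hs hv)⟩

theorem EventAt.of_append {e : Event} {x y l r : List (Tint S M)} (h : e.Tinted z x y) :
    EventAt z l.length e y (l ++ (x ++ r)) (l ++ (y ++ r)) :=
  EventAt.append_iff_zero.2 ⟨_, rfl, .zero h r⟩

theorem exists_append_of_forall₂ {α β : Type*} {r : α → β → Prop} {l₁ l₂ : List α} {m : List β}
    (h : List.Forall₂ r (l₁ ++ l₂) m) :
    ∃ m₁ m₂, m = m₁ ++ m₂ ∧ List.Forall₂ r l₁ m₁ ∧ List.Forall₂ r l₂ m₂ :=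
  ⟨m.take l₁.length, m.drop l₁.length, (List.take_append_drop _ m).symm,
    (List.forall₂_take_append m l₁ l₂ (h.flip)).flip,
    (List.forall₂_drop_append m l₁ l₂ (h.flip)).flip⟩

/-- Each strand met is painted with the colours of its edge; the rule at a vertex is exactly what
the corresponding event demands. -/
theorem exists_run {w : List Slice} {t : ℕ} {σ : List Strand} {vs : List Vertex}
    {σ' : List (Tint S M)} (hr : read t σ w = some vs)
    (hP : ∀ v ∈ vs, ∀ e ∈ v.tops, P e) (hc : Respects z c vs)
    (hσ : List.Forall₂ (Painted c) σ σ') : ∃ ys, Run z σ' w ys [] ∧ Records c t ys := by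
  induction w generalizing t σ vs σ' with
  | nil =>
    obtain ⟨rfl, rfl⟩ := eq_nil_of_read_nil hr
    obtain rfl := List.forall₂_nil_left_iff.1 hσ
    exact ⟨[], .nil _, records_nil t⟩
  | cons s w ih =>
    obtain ⟨i, d | _ | k⟩ := s
    · obtain ⟨l, ρ, us, rfl, rfl, rfl, h⟩ := exists_of_read_cup hr
      obtain ⟨l', ρ', rfl, hl, hρ⟩ := exists_append_of_forall₂ hσ
      have hP' := hP _ List.mem_cons_self
      have h₁ : P (t, false) := hP' _ (by simp [Vertex.tops])
      have h₂ : P (t, true) := hP' _ (by simp [Vertex.tops])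
      have hv := hc.min ⟨_, h₁⟩ ⟨_, h₂⟩ List.mem_cons_self
      have hb : Tint.ofEdge c (!d) ⟨_, h₂⟩ = (Tint.ofEdge c d ⟨_, h₁⟩).bar := by
        ext <;> simp [hv]
      obtain ⟨ys, h3, h4⟩ := ih h (fun v hv => hP v (List.mem_cons_of_mem _ hv))
        (hc.mono (List.subset_cons_self _ _))
        (List.rel_append hl (.cons ⟨h₁, rfl⟩ (.cons ⟨h₂, rfl⟩ hρ)))
      refine ⟨[Tint.ofEdge c d ⟨_, h₁⟩, Tint.ofEdge c (!d) ⟨_, h₂⟩] :: ys, .cons ?_ h3,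
        records_cons_iff.2 ⟨?_, h4⟩⟩
      · rw [hl.length_eq, hb]
        exact EventAt.of_append (.cup (Tint.ofEdge c d ⟨_, h₁⟩))
      · intro a b hab
        simp only [List.cons.injEq, and_true] at hab
        obtain ⟨rfl, rfl⟩ := hab
        exact ⟨_, _, rfl, rfl, rfl, rfl⟩
    · obtain ⟨l, a, b, ρ, us, rfl, rfl, hab, rfl, h⟩ := exists_of_read_cap hr
      obtain ⟨l', ρ', rfl, hl, hρ⟩ := exists_append_of_forall₂ hσ
      obtain ⟨_, _, ⟨ha, rfl⟩, hρ₁, rfl⟩ := List.forall₂_cons_left_iff.1 hρ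
      obtain ⟨_, _, ⟨hb, rfl⟩, hρ₂, rfl⟩ := List.forall₂_cons_left_iff.1 hρ₁
      have hv := hc.max ⟨_, ha⟩ ⟨_, hb⟩ List.mem_cons_self
      have hb : Tint.ofEdge c b.up ⟨_, hb⟩ = (Tint.ofEdge c a.up ⟨_, ha⟩).bar := by
        ext <;> simp [hv, hab]
      obtain ⟨ys, h3, h4⟩ := ih h (fun v hv => hP v (List.mem_cons_of_mem _ hv))
        (hc.mono (List.subset_cons_self _ _)) (List.rel_append hl hρ₂)
      refine ⟨[] :: ys, .cons ?_ h3, records_cons_iff.2 ⟨by simp, h4⟩⟩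
      rw [hl.length_eq, hb]
      exact EventAt.of_append (.cap (Tint.ofEdge c a.up ⟨_, ha⟩))
    · obtain ⟨l, a, b, ρ, us, rfl, rfl, rfl, h⟩ := exists_of_read_cross hr
      obtain ⟨l', ρ', rfl, hl, hρ⟩ := exists_append_of_forall₂ hσ
      obtain ⟨_, _, ⟨ha, rfl⟩, hρ₁, rfl⟩ := List.forall₂_cons_left_iff.1 hρ
      obtain ⟨_, ρ', ⟨hb, rfl⟩, hρ₂, rfl⟩ := List.forall₂_cons_left_iff.1 hρ₁
      have hP' := hP _ List.mem_cons_self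
      have h₁ : P (t, false) := hP' _ (by simp [Vertex.tops])
      have h₂ : P (t, true) := hP' _ (by simp [Vertex.tops])
      have hv := hc.cross k a.up b.up ⟨_, ha⟩ ⟨_, hb⟩ ⟨_, h₁⟩ ⟨_, h₂⟩ List.mem_cons_self
      obtain ⟨ys, h3, h4⟩ := ih h (fun v hv => hP v (List.mem_cons_of_mem _ hv))
        (hc.mono (List.subset_cons_self _ _))
        (List.rel_append hl (.cons ⟨h₁, rfl⟩ (.cons ⟨h₂, rfl⟩ hρ₂)))
      refine ⟨[Tint.ofEdge c b.up ⟨_, h₁⟩, Tint.ofEdge c a.up ⟨_, h₂⟩] :: ys, .cons ?_ h3,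
        records_cons_iff.2 ⟨?_, h4⟩⟩
      · rw [hl.length_eq]
        have := EventAt.of_append (l := l') (r := ρ')
          (Event.Tinted.cross (z := z) k (.ofEdge c a.up ⟨_, ha⟩) (.ofEdge c b.up ⟨_, hb⟩))
        rwa [← hv.1, ← hv.2] at this
      · intro a b hab
        simp only [List.cons.injEq, and_true] at hab
        obtain ⟨rfl, rfl⟩ := hab
        exact ⟨_, _, rfl, rfl, rfl, rfl⟩

/-- Converse of `exists_run`: `Records` ties the strands starting at each event to edges, and the
condition on the event becomes the rule at the vertex. -/
theorem respects_of_run {w : List Slice} {t : ℕ} {σ : List Strand} {vs : List Vertex}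
    {σ' τ : List (Tint S M)} {ys : List (List (Tint S M))} (hr : read t σ w = some vs)
    (hσ : List.Forall₂ (Painted c) σ σ') (hR : Run z σ' w ys τ) (hc : Records c t ys) :
    Respects z c vs := by
  induction w generalizing t σ vs σ' ys with
  | nil =>
    obtain ⟨rfl, rfl⟩ := eq_nil_of_read_nil hr
    constructor <;> simp
  | cons s w ih =>
    obtain ⟨i, e⟩ := s
    obtain ⟨y, ys, ρ', rfl, hE, hR₁⟩ := run_cons_iff.1 hR
    obtain ⟨hy, hc₁⟩ := records_cons_iff.1 hc
    cases e with
    | cup d =>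
      obtain ⟨l, ρ, us, rfl, rfl, rfl, h⟩ := exists_of_read_cup hr
      obtain ⟨l', ρ', rfl, hl, hρ⟩ := exists_append_of_forall₂ hσ
      rw [hl.length_eq, EventAt.append_iff_zero] at hE
      obtain ⟨τ', rfl, hE₀⟩ := hE
      obtain ⟨a, rfl, rfl, rfl⟩ := cup_iff.1 hE₀
      obtain ⟨⟨_, h₁⟩, ⟨_, h₂⟩, rfl, rfl, ha, hb⟩ := hy _ _ rfl
      have ih := ih h (List.rel_append hl (.cons ⟨h₁, ha⟩ (.cons ⟨h₂, hb⟩ hρ))) hR₁ hc₁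
      rw [ha] at hb
      simp only [Tint.ext_iff, Tint.bar_up, Tint.bar_label, Tint.bar_val, Tint.ofEdge_up,
        Tint.ofEdge_label, Tint.ofEdge_val, true_and] at hb
      refine ⟨fun l r hv => ?_, fun l r hv => ?_, fun k u v bl br tl tr hv => ?_⟩
      · rcases List.mem_cons.1 hv with hv | hv
        · obtain ⟨l, hl⟩ := l
          obtain ⟨r, hr⟩ := r
          simp only [Vertex.min.injEq] at hv
          obtain ⟨rfl, rfl⟩ := hv
          exact Prod.ext hb.1.symm hb.2.symm
        · exact ih.min l r hv
      · exact ih.max l r (by simpa using hv)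
      · exact ih.cross k u v bl br tl tr (by simpa using hv)
    | cap =>
      obtain ⟨l, a, b, ρ, us, rfl, rfl, hab, rfl, h⟩ := exists_of_read_cap hr
      obtain ⟨l', ρ', rfl, hl, hρ⟩ := exists_append_of_forall₂ hσ
      obtain ⟨a', _, ⟨ha, ha'⟩, hρ₁, rfl⟩ := List.forall₂_cons_left_iff.1 hρ
      obtain ⟨b', _, ⟨hb, hb'⟩, hρ₂, rfl⟩ := List.forall₂_cons_left_iff.1 hρ₁
      rw [hl.length_eq, EventAt.append_iff_zero] at hE
      obtain ⟨τ', rfl, hE₀⟩ := hE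
      obtain ⟨rfl, a₁, ha₁⟩ := cap_iff.1 hE₀
      simp only [List.cons.injEq] at ha₁
      obtain ⟨rfl, rfl, rfl⟩ := ha₁
      have ih := ih h (List.rel_append hl hρ₂) hR₁ hc₁
      rw [ha'] at hb'
      simp only [Tint.ext_iff, Tint.bar_up, Tint.bar_label, Tint.bar_val, Tint.ofEdge_up,
        Tint.ofEdge_label, Tint.ofEdge_val] at hb'
      refine ⟨fun l r hv => ?_, fun l r hv => ?_, fun k u v bl br tl tr hv => ?_⟩
      · exact ih.min l r (by simpa using hv)
      · rcases List.mem_cons.1 hv with hv | hv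
        · obtain ⟨l, hl⟩ := l
          obtain ⟨r, hr⟩ := r
          simp only [Vertex.max.injEq] at hv
          obtain ⟨rfl, rfl⟩ := hv
          exact Prod.ext hb'.2.1.symm hb'.2.2.symm
        · exact ih.max l r hv
      · exact ih.cross k u v bl br tl tr (by simpa using hv)
    | cross k =>
      obtain ⟨l, a, b, ρ, us, rfl, rfl, rfl, h⟩ := exists_of_read_cross hr
      obtain ⟨l', ρ', rfl, hl, hρ⟩ := exists_append_of_forall₂ hσ
      obtain ⟨a', _, ⟨ha, rfl⟩, hρ₁, rfl⟩ := List.forall₂_cons_left_iff.1 hρ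
      obtain ⟨b', _, ⟨hb, rfl⟩, hρ₂, rfl⟩ := List.forall₂_cons_left_iff.1 hρ₁
      rw [hl.length_eq, EventAt.append_iff_zero] at hE
      obtain ⟨τ', rfl, hE₀⟩ := hE
      obtain ⟨a', b', ρ₁, h₁, rfl, rfl⟩ := cross_iff.1 hE₀
      simp only [List.cons.injEq] at h₁
      obtain ⟨rfl, rfl, rfl⟩ := h₁
      obtain ⟨⟨_, h₁⟩, ⟨_, h₂⟩, rfl, rfl, hl', hr'⟩ := hy _ _ rfl
      rw [Tint.up_topLeft] at hl'
      rw [Tint.up_topRight] at hr'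
      have ih := ih h (List.rel_append hl (.cons ⟨h₁, hl'⟩ (.cons ⟨h₂, hr'⟩ hρ₂))) hR₁ hc₁
      refine ⟨fun l r hv => ?_, fun l r hv => ?_, fun k u v bl br tl tr hv => ?_⟩
      · exact ih.min l r (by simpa using hv)
      · exact ih.max l r (by simpa using hv)
      · rcases List.mem_cons.1 hv with hv | hv
        · obtain ⟨bl, hbl⟩ := bl
          obtain ⟨br, hbr⟩ := br
          obtain ⟨tl, htl⟩ := tl
          obtain ⟨tr, htr⟩ := tr
          simp only [Vertex.cross.injEq] at hv
          obtain ⟨rfl, rfl, rfl, rfl, rfl, rfl, rfl⟩ := hv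
          exact ⟨hl'.symm, hr'.symm⟩
        · exact ih.cross k u v bl br tl tr hv

/-- `Records` leaves orientations open. At a minimum the word prescribes them, and at a crossing the
strands below determine everything. -/
theorem Run.eq_of_records {w : List Slice} {t : ℕ} {σ τ τ' : List (Tint S M)}
    {ys ys' : List (List (Tint S M))} (h : Run z σ w ys τ) (h' : Run z σ w ys' τ')
    (hc : Records c t ys) (hc' : Records c t ys') : ys = ys' := by
  induction w generalizing t σ ys ys' with
  | nil => rw [(run_nil_iff.1 h).1, (run_nil_iff.1 h').1]
  | cons s w ih =>
    obtain ⟨i, e⟩ := s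
    obtain ⟨y, ys, ρ, rfl, hE, hR₁⟩ := run_cons_iff.1 h
    obtain ⟨y', ys', ρ', rfl, hE', hR₁'⟩ := run_cons_iff.1 h'
    obtain ⟨hy, hc₁⟩ := records_cons_iff.1 hc
    obtain ⟨hy', hc₁'⟩ := records_cons_iff.1 hc'
    have hyy : y = y' := by
      obtain ⟨l, σ, ρ, rfl, rfl, rfl, hE₀⟩ := exists_append_of_eventAt hE
      obtain ⟨ρ', rfl, hE₀'⟩ := EventAt.append_iff_zero.1 hE'
      cases e with
      | cup d =>
        obtain ⟨a, hd, rfl, rfl⟩ := cup_iff.1 hE₀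
        obtain ⟨a', hd', rfl, rfl⟩ := cup_iff.1 hE₀'
        obtain ⟨e, -, he, -, ha, -⟩ := hy _ _ rfl
        obtain ⟨e', -, he', -, ha', -⟩ := hy' _ _ rfl
        obtain rfl : e = e' := Subtype.ext (he.trans he'.symm)
        rw [ha, ha', hd, hd']
      | cap => rw [(cap_iff.1 hE₀).1, (cap_iff.1 hE₀').1]
      | cross k =>
        obtain ⟨a, b, ρ, rfl, rfl, rfl⟩ := cross_iff.1 hE₀
        obtain ⟨a', b', ρ', h1, rfl, rfl⟩ := cross_iff.1 hE₀'
        simp_all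
    subst hyy
    obtain rfl := hE.det hE'
    rw [ih hR₁ hR₁' hc₁ hc₁']

/-- An edge is named after the event at its lower end, and exactly the minima and crossings start
two strands, so a run has one entry for each edge. -/
theorem exists_tops_iff {w : List Slice} {t : ℕ} {σ : List Strand} {vs : List Vertex}
    {σ' τ : List (Tint S M)} {ys : List (List (Tint S M))} (hr : read t σ w = some vs)
    (h : Run z σ' w ys τ) (e : EdgeName) :
    (∃ v ∈ vs, e ∈ v.tops) ↔ ∃ j a b, e.1 = t + j ∧ ys[j]? = some [a, b] := by
  induction w generalizing t σ vs σ' ys with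
  | nil =>
    obtain ⟨rfl, rfl⟩ := eq_nil_of_read_nil hr
    obtain ⟨rfl, rfl⟩ := run_nil_iff.1 h
    simp
  | cons s w ih =>
    obtain ⟨i, ev⟩ := s
    obtain ⟨y, ys, ρ', rfl, hE, hR₁⟩ := run_cons_iff.1 h
    have key : ∀ {σ₁ : List Strand} {v : Vertex} {us : List Vertex}, vs = v :: us →
        read (t + 1) σ₁ w = some us → (e ∈ v.tops ↔ e.1 = t ∧ ∃ a b, y = [a, b]) →
        ((∃ v ∈ vs, e ∈ v.tops) ↔ ∃ j a b, e.1 = t + j ∧ (y :: ys)[j]? = some [a, b]) := by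
      rintro σ₁ v us rfl hr' hv
      simp only [List.mem_cons, exists_eq_or_imp, ih hr' hR₁, hv]
      constructor
      · rintro (⟨h1, a, b, rfl⟩ | ⟨j, a, b, h1, h2⟩)
        · exact ⟨0, a, b, h1, rfl⟩
        · exact ⟨j + 1, a, b, by omega, h2⟩
      · rintro ⟨_ | j, a, b, h1, h2⟩
        · exact Or.inl ⟨h1, a, b, by simpa using h2⟩
        · exact Or.inr ⟨j, a, b, by omega, by simpa using h2⟩
    have he : e ∈ [(t, false), (t, true)] ↔ e.1 = t := by
      obtain ⟨e, b⟩ := e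
      cases b <;> simp
    obtain ⟨l, σ, ρ, rfl, rfl, rfl, hE₀⟩ := exists_append_of_eventAt hE
    cases ev with
    | cup d =>
      obtain ⟨a, -, rfl, -⟩ := cup_iff.1 hE₀
      obtain ⟨_, _, us, rfl, _, hvs, h⟩ := exists_of_read_cup hr
      exact key hvs h (by simpa [Vertex.tops] using he)
    | cap =>
      obtain ⟨rfl, -⟩ := cap_iff.1 hE₀
      obtain ⟨_, _, _, _, us, rfl, _, _, hvs, h⟩ := exists_of_read_cap hr
      exact key hvs h (by simp [Vertex.tops])
    | cross k =>
      obtain ⟨a, b, ρ, rfl, rfl, rfl⟩ := cross_iff.1 hE₀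
      obtain ⟨_, _, _, _, us, rfl, _, hvs, h⟩ := exists_of_read_cross hr
      exact key hvs h (by simpa [Vertex.tops] using he)

theorem exists_records {w : List Slice} {vs : List Vertex} {ys : List (List (Tint S M))}
    (hr : read 0 [] w = some vs) (h : Run z [] w ys []) :
    ∃ c : {e // ∃ v ∈ vs, e ∈ v.tops} → S × M, Records c 0 ys := by
  have H : ∀ e : {e // ∃ v ∈ vs, e ∈ v.tops}, ∃ a b, ys[e.1.1]? = some [a, b] := by
    rintro ⟨e, he⟩
    obtain ⟨j, a, b, h1, h2⟩ := (exists_tops_iff hr h e).1 he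
    exact ⟨a, b, by rw [h1, Nat.zero_add, h2]⟩
  choose a b H using H
  refine ⟨fun e => if e.1.2 then ((b e).label, (b e).val) else ((a e).label, (a e).val), ?_⟩
  intro j a' b' hj
  have H' := fun d => (exists_tops_iff hr h (0 + j, d)).2 ⟨j, a', b', rfl, hj⟩
  refine ⟨⟨_, H' false⟩, ⟨_, H' true⟩, rfl, rfl, ?_, ?_⟩
  · have h1 := H ⟨_, H' false⟩
    simp only [Nat.zero_add, hj, Option.some.injEq, List.cons.injEq] at h1
    ext <;> simp [← h1.1]
  · have h1 := H ⟨_, H' true⟩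
    simp only [Nat.zero_add, hj, Option.some.injEq, List.cons.injEq] at h1
    ext <;> simp [← h1.2.1]

end Colours

/-! ### Colourings of closed diagrams -/

section Diagrams

variable {S M S' M' R : Type*} [CommRing R] [AddCommGroup M] [Module R M]
  [AddCommGroup M'] [Module R M'] {z : S → Rˣ} {K K' : Diagram}

theorem Diagram.read_eq (K : Diagram) : read 0 [] K.word = some K.vertices :=
  (Option.some_get K.closed).symm

theorem Respects.exists_run {c : K.Edge → S × M} (h : Respects z c K.vertices) :
    ∃ ys, Run z [] K.word ys [] ∧ Records c 0 ys :=
  Welded.exists_run K.read_eq (fun v hv _ he => ⟨v, hv, he⟩) h .nil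

theorem Run.exists_respects {ys : List (List (Tint S M))} (h : Run z [] K.word ys []) :
    ∃ c : K.Edge → S × M, Records c 0 ys ∧ Respects z c K.vertices := by
  obtain ⟨c, hc⟩ := exists_records K.read_eq h
  exact ⟨c, hc, respects_of_run K.read_eq .nil h hc⟩

theorem Records.map {P : EdgeName → Prop} {c : {e // P e} → S × M} {t : ℕ}
    {ys : List (List (Tint S M))} (h : Records c t ys) (f : S → S') (g : M →+ M') :
    Records (fun e => (f (c e).1, g (c e).2)) t (ys.map (List.map (Tint.map f g))) := by
  intro j a b hj
  simp only [List.getElem?_map, Option.map_eq_some_iff, List.map_eq_cons_iff,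
    List.map_eq_nil_iff] at hj
  obtain ⟨_, hj, a, _, rfl, rfl, b, _, rfl, rfl, rfl⟩ := hj
  obtain ⟨e, e', he, he', ha, hb⟩ := h j a b hj
  refine ⟨e, e', he, he', ?_, ?_⟩
  · conv_lhs => rw [ha]
    rfl
  · conv_lhs => rw [hb]
    rfl

theorem Records.eq {c d : K.Edge → S × M} {ys : List (List (Tint S M))}
    (h : Run z [] K.word ys []) (hc : Records c 0 ys) (hd : Records d 0 ys) : c = d := by
  funext e
  obtain ⟨j, a, b, h1, h2⟩ := (exists_tops_iff K.read_eq h e.1).1 e.2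
  obtain ⟨e₁, e₂, he₁, he₂, ha, hb⟩ := hc j a b h2
  obtain ⟨e₁', e₂', he₁', he₂', ha', hb'⟩ := hd j a b h2
  obtain ⟨⟨t, u⟩, he⟩ := e
  simp only at h1
  subst h1
  cases u
  · obtain rfl := Subtype.ext (a1 := e₁) (a2 := ⟨_, he⟩) he₁
    obtain rfl := Subtype.ext (a1 := e₁') (a2 := ⟨_, he⟩) he₁'
    rw [ha] at ha'
    exact Prod.ext (congrArg Tint.label ha') (congrArg Tint.val ha')
  · obtain rfl := Subtype.ext (a1 := e₂) (a2 := ⟨_, he⟩) he₂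
    obtain rfl := Subtype.ext (a1 := e₂') (a2 := ⟨_, he⟩) he₂'
    rw [hb] at hb'
    exact Prod.ext (congrArg Tint.label hb') (congrArg Tint.val hb')

theorem Respects.topLeft {c : K.Edge → S × M} (h : Respects z c K.vertices) {k : Crossing}
    {u v : Bool} {bl br tl tr : K.Edge} (hv : .cross k u v bl.1 br.1 tl.1 tr.1 ∈ K.vertices) :
    (⟨v, (c tl).1, (c tl).2⟩ : Tint S M) =
      Tint.topLeft z k ⟨u, (c bl).1, (c bl).2⟩ ⟨v, (c br).1, (c br).2⟩ :=
  (h.cross k u v bl br tl tr hv).1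

theorem Respects.topRight {c : K.Edge → S × M} (h : Respects z c K.vertices) {k : Crossing}
    {u v : Bool} {bl br tl tr : K.Edge} (hv : .cross k u v bl.1 br.1 tl.1 tr.1 ∈ K.vertices) :
    (⟨u, (c tr).1, (c tr).2⟩ : Tint S M) =
      Tint.topRight z k ⟨u, (c bl).1, (c bl).2⟩ ⟨v, (c br).1, (c br).2⟩ :=
  (h.cross k u v bl br tl tr hv).2

theorem Respects.label_eq {c : K.Edge → S × M} (h : Respects z c K.vertices) {e e' : K.Edge}
    (hj : K.Joined e e') : (c e).1 = (c e').1 := by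
  cases hj with
  | min hv => rw [h.min _ _ hv]
  | max hv => rw [h.max _ _ hv]
  | risingRight hv => simpa using (congrArg Tint.label (h.topRight hv)).symm
  | risingLeft hv => simpa using (congrArg Tint.label (h.topLeft hv)).symm

theorem Respects.exists_label {c : K.Edge → S × M} (h : Respects z c K.vertices) :
    ∃ φ : K.Component → S, ∀ e, (c e).1 = φ (K.comp e) :=
  ⟨Quot.lift (fun e => (c e).1) fun _ _ hj => h.label_eq hj, fun _ => rfl⟩

/-- If edges are labelled by their circles, only the values have to be checked. -/
theorem respects_of_val (f : K.Component → S) {m : K.Edge → M}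
    (hmin : ∀ l r : K.Edge, Vertex.min l.1 r.1 ∈ K.vertices → m r = -m l)
    (hmax : ∀ l r : K.Edge, Vertex.max l.1 r.1 ∈ K.vertices → m r = -m l)
    (hcross : ∀ (k : Crossing) (u v : Bool) (bl br tl tr : K.Edge),
      Vertex.cross k u v bl.1 br.1 tl.1 tr.1 ∈ K.vertices →
        m tl = (Tint.topLeft z k ⟨u, f (K.comp bl), m bl⟩ ⟨v, f (K.comp br), m br⟩).val ∧
        m tr = (Tint.topRight z k ⟨u, f (K.comp bl), m bl⟩ ⟨v, f (K.comp br), m br⟩).val) :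
    Respects z (fun e => (f (K.comp e), m e)) K.vertices := by
  refine ⟨fun l r hv => Prod.ext (congrArg f (Quot.sound (.min hv)).symm) (hmin l r hv),
    fun l r hv => Prod.ext (congrArg f (Quot.sound (.max hv)).symm) (hmax l r hv),
    fun k u v bl br tl tr hv => ⟨?_, ?_⟩⟩
  · refine Tint.ext (by rw [Tint.up_topLeft]; rfl) ?_ (hcross k u v bl br tl tr hv).1
    rw [Tint.label_topLeft]
    exact congrArg f (Quot.sound (.risingLeft hv)).symm
  · refine Tint.ext (by rw [Tint.up_topRight]; rfl) ?_ (hcross k u v bl br tl tr hv).2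
    rw [Tint.label_topRight]
    exact congrArg f (Quot.sound (.risingRight hv)).symm

end Diagrams

/-! ### Welded equivalence and corresponding colourings -/

section Transfers

variable {R : Type} [CommRing R] {K K' : Diagram}

/-- Trivial values obey all rules, so every labelling of the circles is a colouring. The identity
gives the universal labelling, a constant one the colour-free run. -/
theorem respects_comp {S : Type*} (K : Diagram) (f : K.Component → S) :
    Respects (1 : S → Rˣ) (fun e => (f (K.comp e), ()) : K.Edge → S × Unit) K.vertices :=
  respects_of_val f (fun _ _ _ => rfl) (fun _ _ _ => rfl) (fun _ _ _ _ _ _ _ _ => ⟨rfl, rfl⟩)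

theorem Diagram.WeldedEquiv.transfer (h : K.WeldedEquiv K') :
    Nonempty (Transfer R K.word K'.word) := by
  induction h with
  | rel K K' h =>
    obtain ⟨p, q, A, B, hm, h1, h2⟩ := h
    obtain ⟨ys, hr, -⟩ := (respects_comp (R := R) K fun _ => ()).exists_run
    rw [h1] at hr
    rw [h1, h2]
    exact Transfer.of_move hm ⟨_, _, hr⟩
  | refl K => exact ⟨.refl _⟩
  | symm K K' _ ih => exact ih.map Transfer.symm
  | trans K K' K'' _ _ ih ih' => exact ih.elim fun t => ih'.map t.trans

namespace Transfer

variable (t : Transfer R K.word K'.word) {S M S' M' : Type} [AddCommGroup M] [Module R M]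
  [AddCommGroup M'] [Module R M'] {z : S → Rˣ} {z' : S' → Rˣ}

/-- Corresponding colourings of the edges of two diagrams. -/
def Rel (z : S → Rˣ) (c : K.Edge → S × M) (c' : K'.Edge → S × M) : Prop :=
  ∃ ys ys', t.rel z ys ys' ∧ Records c 0 ys ∧ Records c' 0 ys'

theorem symm_rel_iff {c : K.Edge → S × M} {c' : K'.Edge → S × M} :
    t.symm.Rel z c' c ↔ t.Rel z c c' :=
  ⟨fun ⟨_, _, h, hc, hc'⟩ => ⟨_, _, h, hc', hc⟩, fun ⟨_, _, h, hc, hc'⟩ => ⟨_, _, h, hc', hc⟩⟩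

theorem exists_rel {c : K.Edge → S × M} (h : Respects z c K.vertices) :
    ∃ c' : K'.Edge → S × M, t.Rel z c c' ∧ Respects z c' K'.vertices := by
  obtain ⟨ys, hr, hc⟩ := h.exists_run
  obtain ⟨ys', ht⟩ := t.exists_right hr
  obtain ⟨c', hc', h'⟩ := (t.run_right ht).exists_respects
  exact ⟨c', ⟨_, _, ht, hc, hc'⟩, h'⟩

/-- Edge colours determine the run, the run determines its partner, and the partner its edge
colours. -/
theorem rel_unique {c : K.Edge → S × M} {c' c'' : K'.Edge → S × M} (h : t.Rel z c c')
    (h' : t.Rel z c c'') : c' = c'' := by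
  obtain ⟨ys, ys', ht, hc, hc'⟩ := h
  obtain ⟨zs, zs', ht', hd, hd'⟩ := h'
  obtain rfl := (t.run_left ht).eq_of_records (t.run_left ht') hc hd
  obtain rfl := t.unique_right ht ht'
  exact Records.eq (t.run_right ht) hc' hd'

theorem rel_map {f : S → S'} {g : M →+ M'} (hg : ∀ s m, g (z s • m) = z' (f s) • g m)
    {c : K.Edge → S × M} {c' : K'.Edge → S × M} (h : t.Rel z c c') :
    t.Rel z' (fun e => (f (c e).1, g (c e).2)) (fun e => (f (c' e).1, g (c' e).2)) := by
  obtain ⟨ys, ys', ht, hc, hc'⟩ := h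
  exact ⟨_, _, t.map hg ht, hc.map f g, hc'.map f g⟩

end Transfer

end Transfers

/-! ### `CM(K)` as the universal target of colourings -/

section Module

variable {n : ℕ} {K K' : Diagram}

/-- The variable `X_i` as a unit of the Laurent polynomial ring. -/
noncomputable def LaurentRing.unit (i : Fin n) : (LaurentRing n)ˣ where
  val := LaurentRing.X i 1
  inv := LaurentRing.X i (-1)
  val_inv := by
    simp [LaurentRing.X, AddMonoidAlgebra.single_mul_single,
      AddMonoidAlgebra.one_def]
  inv_val := by
    simp [LaurentRing.X, AddMonoidAlgebra.single_mul_single,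
      AddMonoidAlgebra.one_def]

theorem LaurentRing.unit_zpow_sgn_smul {M : Type*} [AddCommGroup M] [Module (LaurentRing n) M]
    (i : Fin n) (u : Bool) (m : M) :
    LaurentRing.unit i ^ sgn u • m = LaurentRing.X i (sgn u) • m := by
  cases u
  · simp [sgn, LaurentRing.unit, Units.smul_def]
  · simp [sgn, LaurentRing.unit, Units.smul_def]

theorem LaurentRing.unit_zpow_neg_sgn_smul {M : Type*} [AddCommGroup M]
    [Module (LaurentRing n) M] (i : Fin n) (u : Bool) (m : M) :
    LaurentRing.unit i ^ (-sgn u) • m = LaurentRing.X i (-sgn u) • m := by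
  rw [← Tint.sgn_not, unit_zpow_sgn_smul]

/-- The generator of `CM(K)` given by an edge. -/
noncomputable def CM.edge (ℓ : K.Component ≃ Fin n) (e : K.Edge) : CM K ℓ :=
  Submodule.Quotient.mk (gen n e)

theorem CM.hom_ext {ℓ : K.Component ≃ Fin n} {M : Type*} [AddCommGroup M]
    [Module (LaurentRing n) M] {F F' : CM K ℓ →ₗ[LaurentRing n] M}
    (h : ∀ e, F (CM.edge ℓ e) = F' (CM.edge ℓ e)) : F = F' := by
  refine Submodule.linearMap_qext _ (Finsupp.lhom_ext' fun e => LinearMap.ext_ring ?_)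
  exact h e

theorem CM.respects (ℓ : K.Component ≃ Fin n) :
    Respects (fun x => LaurentRing.unit (ℓ x)) (fun e => (K.comp e, CM.edge ℓ e)) K.vertices := by
  have key : ∀ {x y : K.Edge →₀ LaurentRing n}, Relator K ℓ (x - y) →
      (Submodule.Quotient.mk x : CM K ℓ) = Submodule.Quotient.mk y := fun h =>
    (Submodule.Quotient.eq _).2 (Submodule.subset_span h)
  refine respects_of_val id (fun l r hv => key (.min hv)) (fun l r hv => key (.max hv))
    fun k u v bl br tl tr hv => ?_
  cases k
  · simp only [Tint.topLeft, Tint.topRight, LaurentRing.unit_zpow_neg_sgn_smul]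
    exact ⟨key (.overLeft_under hv), key (.overLeft_over hv)⟩
  · simp only [Tint.topLeft, Tint.topRight, LaurentRing.unit_zpow_sgn_smul]
    exact ⟨key (.overRight_over hv), key (.overRight_under hv)⟩
  · exact ⟨key (.virt_left hv), key (.virt_right hv)⟩

/-- `S` and `z` are arbitrary because a transported colouring has its labels among the circles of
the other diagram; only the unit attached to each edge matters. -/
theorem CM.exists_lift {S M : Type*} [AddCommGroup M] [Module (LaurentRing n) M]
    {ℓ : K.Component ≃ Fin n} {z : S → (LaurentRing n)ˣ} {c : K.Edge → S × M}
    (h : Respects z c K.vertices) (hz : ∀ e, z (c e).1 = LaurentRing.unit (ℓ (K.comp e))) :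
    ∃ F : CM K ℓ →ₗ[LaurentRing n] M, ∀ e, F (CM.edge ℓ e) = (c e).2 := by
  have hg : ∀ e, Finsupp.linearCombination (LaurentRing n) (fun e => (c e).2) (gen n e) = (c e).2 :=
    fun e => by simp [gen]
  refine ⟨Submodule.liftQ _ (Finsupp.linearCombination _ fun e => (c e).2) ?_, hg⟩
  rw [Submodule.span_le]
  intro x hx
  rw [SetLike.mem_coe, LinearMap.mem_ker]
  cases hx with
  | min hv => simp [hg, h.min _ _ hv]
  | max hv => simp [hg, h.max _ _ hv]
  | overLeft_under hv =>
    have := congrArg Tint.val (h.topLeft hv)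
    simp only [Tint.topLeft, hz, LaurentRing.unit_zpow_neg_sgn_smul] at this
    simp [hg, this]
  | overLeft_over hv =>
    have := congrArg Tint.val (h.topRight hv)
    simp only [Tint.topRight, hz, LaurentRing.unit_zpow_neg_sgn_smul] at this
    simp [hg, this]
  | overRight_under hv =>
    have := congrArg Tint.val (h.topRight hv)
    simp only [Tint.topRight, hz, LaurentRing.unit_zpow_sgn_smul] at this
    simp [hg, this]
  | overRight_over hv =>
    have := congrArg Tint.val (h.topLeft hv)
    simp only [Tint.topLeft, hz, LaurentRing.unit_zpow_sgn_smul] at this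
    simp [hg, this]
  | virt_left hv =>
    have := congrArg Tint.val (h.topLeft hv)
    simp only [Tint.topLeft] at this
    simp [hg, this]
  | virt_right hv =>
    have := congrArg Tint.val (h.topRight hv)
    simp only [Tint.topRight] at this
    simp [hg, this]

end Module

/-! ### Invariance of the circles and of `CM(K)` -/

section Invariance

/-- Corresponding diagrams have corresponding circles. -/
theorem Transfer.exists_component_equiv {R : Type} [CommRing R] {K K' : Diagram}
    (t : Transfer R K.word K'.word) : ∃ φ : K'.Component ≃ K.Component,
      t.Rel (1 : K.Component → Rˣ) (fun e => (K.comp e, ())) (fun e => (φ (K'.comp e), ())) := by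
  -- The partner of the universal labelling is constant on the circles of `K'`, hence a map `φ`
  -- between circles.
  obtain ⟨c', hc', h'⟩ := t.exists_rel (respects_comp K id)
  obtain ⟨φ, hφ⟩ := h'.exists_label
  obtain rfl : c' = fun e => (φ (K'.comp e), ()) := funext fun e => Prod.ext (hφ e) rfl
  obtain ⟨c, hc, h⟩ := t.symm.exists_rel (respects_comp K' id)
  obtain ⟨ψ, hψ⟩ := h.exists_label
  obtain rfl : c = fun e => (ψ (K.comp e), ()) := funext fun e => Prod.ext (hψ e) rfl
  replace hc := t.symm_rel_iff.1 hc
  have relabel : ∀ {S T : Type} (f : S → T) {c : K.Edge → S × Unit} {d : K'.Edge → S × Unit},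
      t.Rel (1 : S → Rˣ) c d →
      t.Rel (1 : T → Rˣ) (fun e => (f (c e).1, ())) (fun e => (f (d e).1, ())) :=
    fun f _ _ h => t.rel_map (g := (0 : _ →+ Unit)) (fun _ _ => rfl) h
  -- Relabelling one pair by the map obtained from the other gives two partners of the same
  -- labelling, which must coincide.
  refine ⟨⟨φ, ψ, ?_, ?_⟩, hc'⟩
  · rintro ⟨e⟩
    exact congrArg Prod.fst (congrFun (t.rel_unique (relabel ψ hc') hc) e)
  · rintro ⟨e⟩
    exact congrArg Prod.fst (congrFun (t.symm.rel_unique (t.symm_rel_iff.2 (relabel φ hc))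
      (t.symm_rel_iff.2 hc')) e)

/-- Forgetting the values with `g = 0` leaves corresponding labellings, to be compared with the
image under `f` of the matching of circles. -/
theorem Transfer.label_eq {R : Type} [CommRing R] {K K' : Diagram}
    {t : Transfer R K.word K'.word} {φ : K'.Component ≃ K.Component}
    (hφ : t.Rel (1 : K.Component → Rˣ) (fun e => (K.comp e, ())) (fun e => (φ (K'.comp e), ())))
    {S M : Type} [AddCommGroup M] [Module R M] {z : S → Rˣ} (f : K.Component → S)
    {c : K.Edge → S × M} {c' : K'.Edge → S × M} (h : t.Rel z c c') :
    (∀ e, (c e).1 = f (K.comp e)) ↔ ∀ e, (c' e).1 = f (φ (K'.comp e)) := by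
  have h₁ := t.rel_map (z' := (1 : S → Rˣ)) (f := f) (g := (0 : Unit →+ Unit)) (fun _ _ => rfl) hφ
  have h₂ := t.rel_map (z' := (1 : S → Rˣ)) (f := id) (g := (0 : M →+ Unit)) (fun _ _ => rfl) h
  constructor <;> intro hc e
  · simp only [id, hc] at h₂
    exact congrArg Prod.fst (congrFun (t.rel_unique h₂ h₁) e)
  · simp only [id, hc] at h₂
    exact congrArg Prod.fst (congrFun (t.symm.rel_unique (t.symm_rel_iff.2 h₂)
      (t.symm_rel_iff.2 h₁)) e)

/-- Matched circles receive the same number, so that the transported universal colourings use the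
right variables and induce linear maps. -/
theorem Diagram.WeldedEquiv.exists_linearEquiv {n : ℕ} {K K' : Diagram} (h : K.WeldedEquiv K')
    (ℓ : K.Component ≃ Fin n) : ∃ ℓ' : K'.Component ≃ Fin n,
      Nonempty (CM K ℓ ≃ₗ[LaurentRing n] CM K' ℓ') := by
  obtain ⟨t⟩ := h.transfer (R := LaurentRing n)
  obtain ⟨φ, hφ⟩ := t.exists_component_equiv
  obtain ⟨c', hc', hr'⟩ := t.exists_rel (CM.respects ℓ)
  obtain ⟨c, hc, hr⟩ := t.symm.exists_rel (CM.respects (φ.trans ℓ))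
  replace hc := t.symm_rel_iff.1 hc
  have hl' := (Transfer.label_eq hφ id hc').1 fun _ => rfl
  have hl := (Transfer.label_eq hφ φ.symm hc).2 fun _ => (φ.symm_apply_apply _).symm
  obtain ⟨F', hF'⟩ := CM.exists_lift (ℓ := φ.trans ℓ) hr' fun e => by rw [hl']; rfl
  obtain ⟨F, hF⟩ := CM.exists_lift (ℓ := ℓ) hr fun e => by
    rw [hl, Equiv.trans_apply, Equiv.apply_symm_apply]
  refine ⟨φ.trans ℓ, ⟨LinearEquiv.ofLinearMap F F' (CM.hom_ext fun e => ?_)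
    (CM.hom_ext fun e => ?_)⟩⟩
  -- Pushing the universal colouring of `K` and its partner along `F` gives `c` and the image of
  -- `c'`. By `hc` the partner of `c` is the universal colouring of `K'`, so `F ∘ F'` fixes the
  -- generators.
  · have h₁ := t.rel_map (z' := fun x => LaurentRing.unit (φ.trans ℓ x)) (f := φ.symm)
      (g := F.toAddMonoidHom) (fun s m => by simp [Units.smul_def]) hc'
    have h₂ := hc
    obtain rfl : c = fun e => (φ.symm (K.comp e), F (CM.edge ℓ e)) :=
      funext fun e => Prod.ext (hl e) (hF e).symm
    have := congrArg Prod.snd (congrFun (t.rel_unique h₁ h₂) e)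
    simpa [hF'] using this
  · have h₁ := t.rel_map (z' := fun x => LaurentRing.unit (ℓ x)) (f := φ)
      (g := F'.toAddMonoidHom) (fun s m => by simp [Units.smul_def]) hc
    have h₂ := hc'
    obtain rfl : c' = fun e => (φ (K'.comp e), F' (CM.edge (φ.trans ℓ) e)) :=
      funext fun e => Prod.ext (hl' e) (hF' e).symm
    have := congrArg Prod.snd (congrFun (t.symm.rel_unique (t.symm_rel_iff.2 h₁)
      (t.symm_rel_iff.2 h₂)) e)
    simpa [hF] using this

end Invariance

/-! ### Colourings as morphisms of crossed modules -/

section Morphisms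

variable {n : ℕ} {E G : Type*} [CommGroup E] [CommGroup G]

/-- The module over the Laurent polynomials given by an action of the variables. -/
noncomputable abbrev moduleOfAction (β : Multiplicative (Fin n →₀ ℤ) →* MulAut E) :
    Module (LaurentRing n) (Additive E) :=
  Module.compHom (Additive E) (AddMonoidAlgebra.lift ℤ (AddMonoid.End (Additive E)) (Fin n →₀ ℤ)
    { toFun := fun g => MonoidHom.toAdditive (β g).toMonoidHom
      map_one' := by rw [map_one]; rfl
      map_mul' := fun g h => by rw [map_mul]; rfl }).toRingHom

theorem moduleOfAction_X_smul (β : Multiplicative (Fin n →₀ ℤ) →* MulAut E)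
    (g : Multiplicative (Fin n →₀ ℤ)) (e : E) :
    letI := moduleOfAction β
    AddMonoidAlgebra.of ℤ (Fin n →₀ ℤ) g • Additive.ofMul e = Additive.ofMul (β g e) := by
  change AddMonoidAlgebra.lift ℤ (AddMonoid.End (Additive E)) (Fin n →₀ ℤ) _ _ _ = _
  rw [AddMonoidAlgebra.of_apply, AddMonoidAlgebra.lift_single, one_smul]
  rfl

theorem LaurentRing.X_eq_of (i : Fin n) (k : ℤ) :
    LaurentRing.X i k =
      AddMonoidAlgebra.of ℤ (Fin n →₀ ℤ) (Multiplicative.ofAdd (Finsupp.single i k)) :=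
  rfl

/-- The morphism sending the variables to given elements. -/
noncomputable def baseHom (g : Fin n → G) : Multiplicative (Fin n →₀ ℤ) →* G :=
  AddMonoidHom.toMultiplicativeLeft
    (Finsupp.liftAddHom fun i => zmultiplesHom (Additive G) (Additive.ofMul (g i)))

theorem baseHom_single (g : Fin n → G) (i : Fin n) (k : ℤ) :
    baseHom g (Multiplicative.ofAdd (Finsupp.single i k)) = g i ^ k := by
  simp [baseHom]

theorem base_single (β : Multiplicative (Fin n →₀ ℤ) →* G) (i : Fin n) (k : ℤ) :
    β (Multiplicative.ofAdd (Finsupp.single i k)) =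
      β (Multiplicative.ofAdd (Finsupp.single i 1)) ^ k := by
  rw [← map_zpow, ← ofAdd_zsmul, Finsupp.smul_single, smul_eq_mul, mul_one]

theorem base_ext {β β' : Multiplicative (Fin n →₀ ℤ) →* G}
    (h : ∀ i, β (Multiplicative.ofAdd (Finsupp.single i 1)) =
      β' (Multiplicative.ofAdd (Finsupp.single i 1))) : β = β' := by
  have : AddMonoidHom.toMultiplicativeLeft.symm β = AddMonoidHom.toMultiplicativeLeft.symm β' := by
    refine Finsupp.addHom_ext fun i k => ?_
    change Additive.ofMul (β _) = Additive.ofMul (β' _)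
    rw [base_single, base_single β', h]
  exact AddMonoidHom.toMultiplicativeLeft.symm.injective this

variable {𝒢 : CrossedModule E G} {M : Type*} [AddCommGroup M] [Module (LaurentRing n) M]

theorem CrossedModule.Hom.top_of_smul (h : (moduleCrossedModule n M).Hom 𝒢)
    (g : Multiplicative (Fin n →₀ ℤ)) (m : M) :
    h.top (Multiplicative.ofAdd (AddMonoidAlgebra.of ℤ (Fin n →₀ ℤ) g • m)) =
      𝒢.act (h.base g) (h.top (Multiplicative.ofAdd m)) :=
  h.top_act g (Multiplicative.ofAdd m)

theorem CrossedModule.Hom.top_X_smul (h : (moduleCrossedModule n M).Hom 𝒢) (i : Fin n) (k : ℤ)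
    (m : M) :
    h.top (Multiplicative.ofAdd (LaurentRing.X i k • m)) =
      𝒢.act (h.base (Multiplicative.ofAdd (Finsupp.single i 1)) ^ k)
        (h.top (Multiplicative.ofAdd m)) := by
  rw [LaurentRing.X_eq_of, h.top_of_smul, base_single]

/-- The upper part of a morphism, as a linear map. -/
noncomputable def CrossedModule.Hom.linearMap (h : (moduleCrossedModule n M).Hom 𝒢)
    {β : Multiplicative (Fin n →₀ ℤ) →* MulAut E} (hβ : β = 𝒢.act.comp h.base) :
    letI := moduleOfAction β
    M →ₗ[LaurentRing n] Additive E :=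
  letI := moduleOfAction β
  { toFun := fun m => Additive.ofMul (h.top (Multiplicative.ofAdd m))
    map_add' := fun a b => by rw [ofAdd_add, map_mul, ofMul_mul]
    map_smul' := fun r m => by
      let T : M →+ Additive E := AddMonoidHom.toMultiplicativeLeft.symm h.top
      -- Both sides are additive in the scalar, so monomials with coefficient `1` suffice, and there
      -- the claim is equivariance.
      have key : T.comp ((smulAddHom (LaurentRing n) M).flip m) =
          (smulAddHom (LaurentRing n) (Additive E)).flip (T m) := by
        refine AddMonoidAlgebra.addHom_ext' fun a => AddMonoidHom.ext_int ?_
        have h₁ := h.top_of_smul (Multiplicative.ofAdd a) m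
        have h₂ := moduleOfAction_X_smul β (Multiplicative.ofAdd a) (h.top (Multiplicative.ofAdd m))
        subst hβ
        exact (congrArg Additive.ofMul h₁).trans h₂.symm
      exact DFunLike.congr_fun key r }

variable {K : Diagram} {ℓ : K.Component ≃ Fin n}

/-- Every circle contains an edge, so the bases agree on the variables. The edges generate `CM(K)`
only as a module, so the upper parts must be compared as linear maps. -/
theorem CrossedModule.Hom.ext_edge {h h' : (moduleCrossedModule n (CM K ℓ)).Hom 𝒢}
    (hb : ∀ e, h.base (Multiplicative.ofAdd (Finsupp.single (ℓ (K.comp e)) 1)) =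
      h'.base (Multiplicative.ofAdd (Finsupp.single (ℓ (K.comp e)) 1)))
    (ht : ∀ e, h.top (Multiplicative.ofAdd (CM.edge ℓ e)) =
      h'.top (Multiplicative.ofAdd (CM.edge ℓ e))) : h = h' := by
  replace hb : h.base = h'.base := by
    refine base_ext fun i => ?_
    obtain ⟨⟨e⟩, rfl⟩ := ℓ.surjective i
    exact hb e
  -- Equal bases induce the same module structure on `E`; passing `β` with an equation puts both
  -- maps into one type.
  have hl : h.linearMap rfl = h'.linearMap (by rw [hb]) := by
    let _ := moduleOfAction (𝒢.act.comp h.base)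
    exact CM.hom_ext fun e => congrArg Additive.ofMul (ht e)
  replace ht : h.top = h'.top := by
    refine MonoidHom.ext fun m => ?_
    exact congrArg (fun F => Additive.toMul (F (Multiplicative.toAdd m))) hl
  obtain ⟨top, base, _, _⟩ := h
  obtain ⟨top', base', _, _⟩ := h'
  obtain rfl : top = top' := ht
  obtain rfl : base = base' := hb
  rfl

/-- The colouring of the edges given by a morphism. -/
noncomputable def CrossedModule.Hom.colouring (h : (moduleCrossedModule n (CM K ℓ)).Hom 𝒢)
    (e : K.Edge) : G × E :=
  (h.base (Multiplicative.ofAdd (Finsupp.single (ℓ (K.comp e)) 1)),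
    h.top (Multiplicative.ofAdd (CM.edge ℓ e)))

theorem CrossedModule.Hom.isReducedColouring (h : (moduleCrossedModule n (CM K ℓ)).Hom 𝒢) :
    IsReducedColouring 𝒢 K h.colouring := by
  have hr := CM.respects ℓ
  have hj : ∀ {e e' : K.Edge}, K.Joined e e' → (h.colouring e').1 = (h.colouring e).1 :=
    fun hj => by rw [colouring, colouring, Diagram.comp, Diagram.comp, Quot.sound hj]
  refine ⟨fun l r hv => ⟨hj (.min hv), ?_⟩, fun l r hv => ⟨hj (.max hv), ?_⟩,
    fun u v bl br tl tr hv X Y Z e f hX hY hZ => ?_,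
    fun u v bl br tl tr hv X Y Z e f hX hY hZ => ?_,
    fun u v bl br tl tr hv => ?_⟩
  · have := congrArg Prod.snd (hr.min l r hv)
    simp only [colouring] at this ⊢
    rw [this, ofAdd_neg, map_inv]
  · have := congrArg Prod.snd (hr.max l r hv)
    simp only [colouring] at this ⊢
    rw [this, ofAdd_neg, map_inv]
  · have h1 := congrArg Tint.val (hr.topLeft hv)
    have h2 := congrArg Tint.val (hr.topRight hv)
    simp only [Tint.topLeft, Tint.topRight, LaurentRing.unit_zpow_neg_sgn_smul] at h1 h2
    subst hZ
    obtain ⟨rfl, rfl⟩ := Prod.ext_iff.1 hX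
    obtain ⟨rfl, rfl⟩ := Prod.ext_iff.1 hY
    refine ⟨Prod.ext ?_ ?_, Prod.ext (hj (.risingRight hv)) ?_⟩
    · rw [hj (.risingLeft hv), mul_comm _ (h.colouring br).1, mul_inv_cancel_right]
    · simp only [colouring]
      rw [h1, h.top_X_smul]
    · simp only [colouring]
      rw [h2, ofAdd_sub, ofAdd_add, map_div, map_mul, h.top_X_smul, div_eq_mul_inv, map_inv]
  · have h1 := congrArg Tint.val (hr.topLeft hv)
    have h2 := congrArg Tint.val (hr.topRight hv)
    simp only [Tint.topLeft, Tint.topRight, LaurentRing.unit_zpow_sgn_smul] at h1 h2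
    subst hZ
    obtain ⟨rfl, rfl⟩ := Prod.ext_iff.1 hX
    obtain ⟨rfl, rfl⟩ := Prod.ext_iff.1 hY
    refine ⟨Prod.ext (hj (.risingLeft hv)) ?_, Prod.ext ?_ ?_⟩
    · simp only [colouring]
      rw [h1, ofAdd_sub, ofAdd_add, map_div, map_mul, h.top_X_smul, div_eq_mul_inv, map_inv]
    · rw [hj (.risingRight hv), mul_comm _ (h.colouring bl).1, mul_inv_cancel_right]
    · simp only [colouring]
      rw [h2, h.top_X_smul]
  · have h1 := congrArg Tint.val (hr.topLeft hv)
    have h2 := congrArg Tint.val (hr.topRight hv)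
    simp only [Tint.topLeft, Tint.topRight] at h1 h2
    refine ⟨Prod.ext (hj (.risingLeft hv)) ?_, Prod.ext (hj (.risingRight hv)) ?_⟩
    · simp only [colouring]
      rw [h1]
    · simp only [colouring]
      rw [h2]

/-- Conjugation by `Z` is trivial in the abelian group `G`. -/
theorem IsReducedColouring.fst_eq {c : K.Edge → G × E} (hc : IsReducedColouring 𝒢 K c)
    {e e' : K.Edge} (hj : K.Joined e e') : (c e).1 = (c e').1 := by
  cases hj with
  | min hv => exact (hc.min _ _ hv).1.symm
  | max hv => exact (hc.max _ _ hv).1.symm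
  | @risingRight k u v bl br tl tr hv =>
    cases k
    · rw [(hc.overLeft _ _ _ _ _ _ hv _ _ _ _ _ rfl rfl rfl).2]
    · rw [(hc.overRight _ _ _ _ _ _ hv _ _ _ _ _ rfl rfl rfl).2]
      simp [mul_comm]
    · rw [(hc.virt _ _ _ _ _ _ hv).2]
  | @risingLeft k u v bl br tl tr hv =>
    cases k
    · rw [(hc.overLeft _ _ _ _ _ _ hv _ _ _ _ _ rfl rfl rfl).1]
      simp [mul_comm]
    · rw [(hc.overRight _ _ _ _ _ _ hv _ _ _ _ _ rfl rfl rfl).1]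
    · rw [(hc.virt _ _ _ _ _ _ hv).1]

/-- The colours of the circles are the images of the variables and make `E` a module; the
`E`-colours then satisfy the relations of `CM(K)` and extend linearly. Both boundaries being
trivial, the boundary condition is automatic. -/
theorem IsReducedColouring.exists_hom (h𝒢 : 𝒢.IsAutomorphic) {c : K.Edge → G × E}
    (hc : IsReducedColouring 𝒢 K c) :
    ∃ h : (moduleCrossedModule n (CM K ℓ)).Hom 𝒢, h.colouring = c := by
  let g : K.Component → G := Quot.lift (fun e => (c e).1) fun _ _ hj => hc.fst_eq hj
  have hg : ∀ e, g (K.comp e) = (c e).1 := fun _ => rfl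
  let β := baseHom fun i => g (ℓ.symm i)
  let _ := moduleOfAction (𝒢.act.comp β)
  have hX : ∀ (e : K.Edge) (k : ℤ) (f : E),
      LaurentRing.X (ℓ (K.comp e)) k • Additive.ofMul f = Additive.ofMul (𝒢.act ((c e).1 ^ k) f) := by
    intro e k f
    rw [LaurentRing.X_eq_of, moduleOfAction_X_smul, MonoidHom.comp_apply, baseHom_single,
      Equiv.symm_apply_apply, hg]
  have hr : Respects (fun x => LaurentRing.unit (ℓ x))
      (fun e => (K.comp e, Additive.ofMul (c e).2)) K.vertices := by
    refine respects_of_val id (fun l r hv => congrArg Additive.ofMul (hc.min l r hv).2)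
      (fun l r hv => congrArg Additive.ofMul (hc.max l r hv).2) fun k u v bl br tl tr hv => ?_
    cases k
    · obtain ⟨h1, h2⟩ := hc.overLeft u v bl br tl tr hv _ _ _ _ _ rfl rfl rfl
      simp only [Tint.topLeft, Tint.topRight, LaurentRing.unit_zpow_neg_sgn_smul, id, hX, h1, h2,
        map_inv, ← div_eq_mul_inv, ofMul_div, ofMul_mul, and_self]
    · obtain ⟨h1, h2⟩ := hc.overRight u v bl br tl tr hv _ _ _ _ _ rfl rfl rfl
      simp only [Tint.topLeft, Tint.topRight, LaurentRing.unit_zpow_sgn_smul, id, hX, h1, h2,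
        map_inv, ← div_eq_mul_inv, ofMul_div, ofMul_mul, and_self]
    · obtain ⟨h1, h2⟩ := hc.virt u v bl br tl tr hv
      simp only [Tint.topLeft, Tint.topRight, h1, h2, and_self]
  obtain ⟨F, hF⟩ := CM.exists_lift (ℓ := ℓ) hr fun _ => rfl
  refine ⟨⟨AddMonoidHom.toMultiplicativeLeft (F : CM K ℓ →+ Additive E), β,
    fun e => ?_, fun X e => ?_⟩, ?_⟩
  · rw [h𝒢]
    exact (map_one β).symm
  · change Additive.toMul (F (AddMonoidAlgebra.of ℤ (Fin n →₀ ℤ) X • Multiplicative.toAdd e)) = _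
    rw [map_smul]
    exact congrArg Additive.toMul (moduleOfAction_X_smul (𝒢.act.comp β) X
      (Additive.toMul (F (Multiplicative.toAdd e))))
  · funext e
    refine Prod.ext ?_ ?_
    · refine (baseHom_single _ _ _).trans ?_
      rw [zpow_one, Equiv.symm_apply_apply, hg]
    · exact congrArg Additive.toMul (hF e)

theorem colouringNumber_eq_card_hom (h𝒢 : 𝒢.IsAutomorphic) (ℓ : K.Component ≃ Fin n) :
    colouringNumber 𝒢 K = Nat.card ((moduleCrossedModule n (CM K ℓ)).Hom 𝒢) := by
  refine (Nat.card_eq_of_bijective (fun h => ⟨h.colouring, h.isReducedColouring⟩)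
    ⟨fun h h' hh => ?_, fun ⟨c, hc⟩ => ?_⟩).symm
  · have hc := congrArg Subtype.val hh
    exact CrossedModule.Hom.ext_edge (fun e => congrArg Prod.fst (congrFun hc e))
      fun e => congrArg Prod.snd (congrFun hc e)
  · obtain ⟨h, hh⟩ := hc.exists_hom (ℓ := ℓ) h𝒢
    exact ⟨h, Subtype.ext hh⟩

end Morphisms

/-- With trivial boundary the Peiffer identity says that conjugation in `E` is trivial. -/
theorem CrossedModule.IsAutomorphic.mul_comm {E G : Type*} [Group E] [Group G]
    {𝒢 : CrossedModule E G} (h : 𝒢.IsAutomorphic) (e f : E) : e * f = f * e := by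
  have := 𝒢.act_bd e f
  rw [h e, map_one, MulAut.one_apply] at this
  rw [eq_mul_inv_iff_mul_eq] at this
  exact this.symm

end Welded

theorem mainTheorem2 (n : ℕ) (K : Welded.Diagram) (ℓ : K.Component ≃ Fin n) :
    (∀ K' : Welded.Diagram, K.WeldedEquiv K' →
      ∃ ℓ' : K'.Component ≃ Fin n,
        Nonempty (Welded.CM K ℓ ≃ₗ[Welded.LaurentRing n] Welded.CM K' ℓ')) ∧
    (∀ (E : Type*) (G : Type*) [Group E] [CommGroup G] [Finite E] [Finite G]
      (𝒢 : Welded.CrossedModule E G), 𝒢.IsAutomorphic →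
        Welded.colouringNumber 𝒢 K =
          Nat.card (Welded.CrossedModule.Hom
            (Welded.moduleCrossedModule n (Welded.CM K ℓ)) 𝒢)) := by
  refine ⟨fun K' h => h.exists_linearEquiv ℓ, fun E G _ _ _ _ 𝒢 h𝒢 => ?_⟩
  let _ : CommGroup E := { ‹Group E› with mul_comm := h𝒢.mul_comm }
  exact Welded.colouringNumber_eq_card_hom h𝒢 ℓ
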